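/- Everything is of class $C^\infty$ and real. Let $M$ be a Hausdorff $n$-dimensional manifold with a foliation $\mathcal F$ of dimension $p$ and codimension $q=n-p$, and let $\nu^*\mathcal F\subseteq T^*M$ be the annihilator of $T\mathcal F$. A foliated $1$-form on an open set $U$ is a section $\alpha$ of $\nu^*\mathcal F$ over $U$ with $i(Y)\,d\alpha=0$ for all $Y$ tangent to $\mathcal F$; a foliated vector field on $U$ is a field $X$ with $[X,Y]$ tangent to $\mathcal F$ for all local fields $Y$ tangent to $\mathcal F$. Let $h:\nu^*\mathcal F\to TM$ be a hamiltonian structure of $\mathcal F$: a vector bundle morphism such that, over every open set $U$, the induced map $H$ on foliated $1$-forms is skew symmetric ($\langle\alpha,H\beta\rangle=-\langle\beta,H\alpha\rangle$), has foliated vector fields as values, and satisfies $$\sum_{\mathrm{Cycl}(\alpha,\beta,\gamma)}\langle H L_{H\alpha}\beta,\gamma\rangle=0$$ for all foliated $1$-forms $\alpha,\beta,\gamma$ on $U$. Let $h$ be tame with image extension $E$: $E$ is a distribution (vector subbundle of $TM$) with $TM=E\oplus T\mathcal F$ and $\operatorname{im}h\subseteq E$, and $[X,Y]$ takes values in $E$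 for all vector fields $X,Y$ on $M$ with values in $\operatorname{im}h$. Let $p_E:TM\to TM$ be the projection onto $E$ along $T\mathcal F$. The forms of bidegree $(1,0)$ are the sections of $\nu^*\mathcal F$. For a function $f$ and a $(1,0)$-form $\alpha$, let $d'f=df\circ p_E$ and $d'\alpha=d\alpha(p_E\cdot,p_E\cdot)$ be the $(1,0)$- and the $(2,0)$-component of $df$ and $d\alpha$. Put $L'_X=i(X)d'+d'i(X)$ for $X\in\Gamma E$, and $$\{f,g\}'=\langle H d'f,dg\rangle\quad(f,g\in C^\infty(M)),$$ $$\{\alpha,\beta\}'=L'_{H\alpha}\beta-L'_{H\beta}\alpha-d'\langle H\alpha,\beta\rangle\quad(\alpha,\beta\in\Gamma(\nu^*\mathcal F)).$$ Then there is exactly one bivector field $P$ on $M$ with $P(df,dg)=\{f,g\}'$ for all $f,g\in C^\infty(M)$, and $P$ is a Poisson structure. Let $\sharp_P:T^*M\to TM$ be given by $\langle\sharp_P\alpha,\beta\rangle=P(\alpha,\beta)$, and let $$\{\alpha,\beta\}_P=L_{\sharp_P\alpha}\beta-L_{\sharp_P\beta}\alpha-d\langle\sharp_P\alpha,\beta\rangle\quad(\alpha,\beta\in\Gamma(T^*M)).$$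 Then $(T^*M,\{\,,\}_P,\sharp_P)$ is a Lie algebroid, and the triple $(\nu^*\mathcal F,\{\,,\}',h)$ is a Lie subalgebroid of it: $\nu^*\mathcal F$ is a vector subbundle of $T^*M$, $\{\,,\}'$ and $h$ make it a Lie algebroid, and $\{\alpha,\beta\}'=\{\alpha,\beta\}_P$ and $h\alpha=\sharp_P\alpha$ for all sections $\alpha,\beta$ of $\nu^*\mathcal F$. -/

import Mathlib

open Bundle Set
open scoped Manifold ContDiff

noncomputable section

namespace FoliationHamiltonian

/-! ## Smooth subbundles and Lie algebroids -/

section Algebroids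

/-- The model space of an `n`-dimensional manifold. -/
abbrev ModelSp (n : ℕ) : Type := EuclideanSpace ℝ (Fin n)

/-- The tangent space `T_x M`. -/
abbrev Tan (n : ℕ) {M : Type*} [TopologicalSpace M] [ChartedSpace (ModelSp n) M] (x : M) : Type :=
  TangentSpace 𝓘(ℝ, ModelSp n) x

/-- The cotangent space `T*_x M`. -/
abbrev Cot (n : ℕ) {M : Type*} [TopologicalSpace M] [ChartedSpace (ModelSp n) M] (x : M) : Type :=
  TangentSpace 𝓘(ℝ, ModelSp n) x →L[ℝ] ℝ

/-- The differential `df` of a function. -/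
def dFun {n : ℕ} {M : Type*} [TopologicalSpace M] [ChartedSpace (ModelSp n) M]
    (f : M → ℝ) (x : M) : Cot n x := mfderiv 𝓘(ℝ, ModelSp n) 𝓘(ℝ, ℝ) f x

/-- Smoothness over `U` of a (not necessarily global) section of a vector bundle `V`
with model fibre `F`. -/
def SmoothOn (n : ℕ) {M : Type*} [TopologicalSpace M] [ChartedSpace (ModelSp n) M]
    (F : Type*) [NormedAddCommGroup F] [NormedSpace ℝ F]
    (V : M → Type*) [TopologicalSpace (TotalSpace F V)] [∀ x, TopologicalSpace (V x)]
    [FiberBundle F V] (s : ∀ x, V x) (U : Set M) : Prop :=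
  ContMDiffOn 𝓘(ℝ, ModelSp n) (𝓘(ℝ, ModelSp n).prod 𝓘(ℝ, F)) ∞ (fun x => TotalSpace.mk' F x (s x)) U

/-- A smooth vector subbundle of `V`: a family of subspaces which locally has a smooth frame. -/
def IsSmoothSubbundle (n : ℕ) {M : Type*} [TopologicalSpace M] [ChartedSpace (ModelSp n) M]
    (F : Type*) [NormedAddCommGroup F] [NormedSpace ℝ F]
    (V : M → Type*) [TopologicalSpace (TotalSpace F V)] [∀ x, TopologicalSpace (V x)]
    [FiberBundle F V] [∀ x, AddCommGroup (V x)] [∀ x, Module ℝ (V x)]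
    (A : ∀ x, Submodule ℝ (V x)) : Prop :=
  ∀ x : M, ∃ U : Set M, IsOpen U ∧ x ∈ U ∧ ∃ (r : ℕ) (s : Fin r → ∀ y, V y),
    (∀ i, SmoothOn n F V (s i) U) ∧
    ∀ y ∈ U, LinearIndependent ℝ (fun i => s i y) ∧
      Submodule.span ℝ (range (fun i => s i y)) = A y

/-- A fibrewise linear map `ρ : A → TM` over the identity, defined on a subbundle `A` of `V`, is
a smooth vector bundle morphism: it sends smooth local sections to smooth local vector fields. -/
def IsSmoothMorphism (n : ℕ) {M : Type*} [TopologicalSpace M] [ChartedSpace (ModelSp n) M]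
    [IsManifold 𝓘(ℝ, ModelSp n) ∞ M]
    (F : Type*) [NormedAddCommGroup F] [NormedSpace ℝ F]
    (V : M → Type*) [TopologicalSpace (TotalSpace F V)] [∀ x, TopologicalSpace (V x)]
    [FiberBundle F V] [∀ x, AddCommGroup (V x)] [∀ x, Module ℝ (V x)]
    (A : ∀ x, Submodule ℝ (V x)) (ρ : ∀ x, A x →ₗ[ℝ] TangentSpace 𝓘(ℝ, ModelSp n) x) : Prop :=
  ∀ (U : Set M) (s : ∀ x, A x), IsOpen U → SmoothOn n F V (fun x => (s x : V x)) U →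
    SmoothOn n (ModelSp n) (TangentSpace 𝓘(ℝ, ModelSp n) (M := M)) (fun x => ρ x (s x)) U

/-- The space `Γ A` of global smooth sections of `V` with values in `A`. -/
def Sections (n : ℕ) {M : Type*} [TopologicalSpace M] [ChartedSpace (ModelSp n) M]
    (F : Type*) [NormedAddCommGroup F] [NormedSpace ℝ F]
    (V : M → Type*) [TopologicalSpace (TotalSpace F V)] [∀ x, TopologicalSpace (V x)]
    [FiberBundle F V] [∀ x, AddCommGroup (V x)] [∀ x, Module ℝ (V x)] [VectorBundle ℝ F V]
    (A : ∀ x, Submodule ℝ (V x)) : Submodule ℝ Cₛ^∞⟮𝓘(ℝ, ModelSp n); F, V⟯ where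
  carrier := {s | ∀ x, s x ∈ A x}
  add_mem' := fun ha hb x => (A x).add_mem (ha x) (hb x)
  zero_mem' := fun x => (A x).zero_mem
  smul_mem' := fun c _ ha x => (A x).smul_mem c (ha x)

/-- The product `f s` of a smooth function and a section of `A`. -/
def Sections.mulFun {n : ℕ} {M : Type*} [TopologicalSpace M] [ChartedSpace (ModelSp n) M]
    {F : Type*} [NormedAddCommGroup F] [NormedSpace ℝ F]
    {V : M → Type*} [TopologicalSpace (TotalSpace F V)] [∀ x, TopologicalSpace (V x)]
    [FiberBundle F V] [∀ x, AddCommGroup (V x)] [∀ x, Module ℝ (V x)] [VectorBundle ℝ F V]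
    {A : ∀ x, Submodule ℝ (V x)} (f : C^∞⟮𝓘(ℝ, ModelSp n), M; ℝ⟯) (s : Sections n F V A) :
    Sections n F V A :=
  ⟨⟨fun x => f x • s.1 x, f.contMDiff.smul_section s.1.contMDiff⟩,
    fun x => (A x).smul_mem _ (s.2 x)⟩

/-- A Lie algebroid structure on a smooth vector subbundle `A` of `V` (for `A = ⊤`, on `V`):
a Lie bracket on the smooth sections and an anchor `A → TM`, a smooth bundle morphism inducing a
homomorphism of Lie algebras on sections, related by the Leibniz rule. -/
structure LieAlgebroid (n : ℕ) {M : Type*} [TopologicalSpace M] [ChartedSpace (ModelSp n) M]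
    [IsManifold 𝓘(ℝ, ModelSp n) ∞ M]
    (F : Type*) [NormedAddCommGroup F] [NormedSpace ℝ F]
    (V : M → Type*) [TopologicalSpace (TotalSpace F V)] [∀ x, TopologicalSpace (V x)]
    [FiberBundle F V] [∀ x, AddCommGroup (V x)] [∀ x, Module ℝ (V x)] [VectorBundle ℝ F V]
    (A : ∀ x, Submodule ℝ (V x)) where
  isSubbundle : IsSmoothSubbundle n F V A
  anchor : ∀ x, A x →ₗ[ℝ] TangentSpace 𝓘(ℝ, ModelSp n) x
  anchor_smooth : IsSmoothMorphism n F V A anchor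
  bracket : Sections n F V A →ₗ[ℝ] Sections n F V A →ₗ[ℝ] Sections n F V A
  bracket_skew : ∀ s t, bracket s t = - bracket t s
  jacobi : ∀ s t u,
    bracket (bracket s t) u + bracket (bracket t u) s + bracket (bracket u s) t = 0
  leibniz : ∀ (s t : Sections n F V A) (f : C^∞⟮𝓘(ℝ, ModelSp n), M; ℝ⟯) (x : M),
    (bracket s (Sections.mulFun f t)).1 x =
      f x • (bracket s t).1 x +
        dFun f x (anchor x ⟨s.1 x, s.2 x⟩) • t.1 x
  anchor_bracket : ∀ (s t : Sections n F V A) (x : M),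
    anchor x ⟨(bracket s t).1 x, (bracket s t).2 x⟩ =
      VectorField.mlieBracket 𝓘(ℝ, ModelSp n) (fun y => anchor y ⟨s.1 y, s.2 y⟩)
        (fun y => anchor y ⟨t.1 y, t.2 y⟩) x

/-- `a` is a Lie subalgebroid of `b` (over the same base): `A` is a subbundle of `B`, and the
inclusion preserves anchors and brackets. -/
def LieAlgebroid.IsSubalgebroid {n : ℕ} {M : Type*} [TopologicalSpace M] [ChartedSpace (ModelSp n) M]
    [IsManifold 𝓘(ℝ, ModelSp n) ∞ M]
    {F : Type*} [NormedAddCommGroup F] [NormedSpace ℝ F]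
    {V : M → Type*} [TopologicalSpace (TotalSpace F V)] [∀ x, TopologicalSpace (V x)]
    [FiberBundle F V] [∀ x, AddCommGroup (V x)] [∀ x, Module ℝ (V x)] [VectorBundle ℝ F V]
    {A B : ∀ x, Submodule ℝ (V x)} (a : LieAlgebroid n F V A)
    (b : LieAlgebroid n F V B) : Prop :=
  (∀ x, A x ≤ B x) ∧
  (∀ (x : M) (v : V x) (hA : v ∈ A x) (hB : v ∈ B x), a.anchor x ⟨v, hA⟩ = b.anchor x ⟨v, hB⟩) ∧
  ∀ (s t : Sections n F V A) (s' t' : Sections n F V B),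
    s.1 = s'.1 → t.1 = t'.1 → (a.bracket s t).1 = (b.bracket s' t').1

end Algebroids

/-! ## Differential 1-forms -/

section Forms

/-- The model fibre of the cotangent bundle. -/
abbrev CotMod (n : ℕ) : Type := ModelSp n →L[ℝ] ℝ

variable {n : ℕ} {M : Type*} [TopologicalSpace M] [ChartedSpace (ModelSp n) M]

/-- The expression of the 1-form `α` in the preferred chart at `x`: the pullback of `α` under the
inverse of that chart. -/
def chartForm (α : ∀ x : M, Cot n x) (x : M) (z : ModelSp n) : CotMod n :=
  (α ((extChartAt 𝓘(ℝ, ModelSp n) x).symm z)).comp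
    (mfderiv 𝓘(ℝ, ModelSp n) 𝓘(ℝ, ModelSp n) (extChartAt 𝓘(ℝ, ModelSp n) x).symm z)

/-- The derivative at `x` of the preferred chart at `x`. -/
def chartDeriv (x : M) : Tan n x →L[ℝ] ModelSp n :=
  mfderiv 𝓘(ℝ, ModelSp n) 𝓘(ℝ, ModelSp n) (extChartAt 𝓘(ℝ, ModelSp n) x) x

/-- The contraction `i(v) dα` at `x` of the exterior derivative of a 1-form `α` with `v ∈ T_x M`:
in the preferred chart, `dα(v, w) = (D_v α)(w) - (D_w α)(v)`. -/
def dForm (α : ∀ x : M, Cot n x) (x : M) (v : Tan n x) : Cot n x :=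
  let D : ModelSp n →L[ℝ] CotMod n := fderiv ℝ (chartForm α x) (extChartAt 𝓘(ℝ, ModelSp n) x x)
  (D (chartDeriv x v)).comp (chartDeriv x) -
    ((ContinuousLinearMap.apply ℝ ℝ (chartDeriv x v)).comp D).comp (chartDeriv x)

/-- The Lie derivative `L_X α = d i(X) α + i(X) dα` of a 1-form. -/
def lieDeriv (X : ∀ x : M, Tan n x) (α : ∀ x : M, Cot n x) (x : M) : Cot n x :=
  dFun (fun y => α y (X y)) x + dForm α x (X x)

/-- A smooth bivector field `P`, given by the morphism `♯_P : T*M → TM`,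
`⟨♯_P α, β⟩ = P(α, β)`. -/
structure BivectorField (n : ℕ) (M : Type*) [TopologicalSpace M] [ChartedSpace (ModelSp n) M]
    [IsManifold 𝓘(ℝ, ModelSp n) ∞ M] where
  sharp : ∀ x : M, Cot n x →ₗ[ℝ] Tan n x
  skew : ∀ (x : M) (α β : Cot n x), β (sharp x α) = - α (sharp x β)
  smooth : ∀ (U : Set M) (α : ∀ x : M, Cot n x), IsOpen U →
    SmoothOn n (CotMod n) (Cot n (M := M)) α U →
      SmoothOn n (ModelSp n) (Tan n (M := M)) (fun x => sharp x (α x)) U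

namespace BivectorField

variable [IsManifold 𝓘(ℝ, ModelSp n) ∞ M]

/-- The bracket `{f, g} = P(df, dg)`. -/
def funBracket (P : BivectorField n M) (f g : M → ℝ) (x : M) : ℝ :=
  dFun g x (P.sharp x (dFun f x))

/-- `P` is a Poisson structure: `{f, g} = P(df, dg)` satisfies the Jacobi identity. -/
def IsPoisson (P : BivectorField n M) : Prop :=
  ∀ (f g k : C^∞⟮𝓘(ℝ, ModelSp n), M; ℝ⟯) (x : M),
    P.funBracket (P.funBracket f g) k x + P.funBracket (P.funBracket g k) f x +
      P.funBracket (P.funBracket k f) g x = 0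

/-- The bracket `{α, β}_P = L_{♯α} β - L_{♯β} α - d⟨♯α, β⟩` of 1-forms. -/
def formBracket (P : BivectorField n M) (α β : ∀ x : M, Cot n x) (x : M) : Cot n x :=
  lieDeriv (fun y => P.sharp y (α y)) β x - lieDeriv (fun y => P.sharp y (β y)) α x -
    dFun (fun y => β y (P.sharp y (α y))) x

end BivectorField

end Forms

/-! ## Foliations -/

section Foliations

/-- A foliation of codimension `q` and dimension `p` of a `(q + p)`-dimensional manifold, given by
its tangent distribution `TF`. Around each point there are adapted coordinates `(x^a, y^u)`,
namely a chart of `M` such that `TF` is defined by `dx^a = 0`, where `x^a` are the first `q`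
coordinates. -/
structure Foliation (q p : ℕ) (M : Type*) [TopologicalSpace M] [ChartedSpace (ModelSp (q + p)) M]
    [IsManifold 𝓘(ℝ, ModelSp (q + p)) ∞ M] where
  tangent : ∀ x : M, Submodule ℝ (Tan (q + p) x)
  exists_adapted : ∀ x : M, ∃ e ∈ IsManifold.maximalAtlas 𝓘(ℝ, ModelSp (q + p)) ∞ M, x ∈ e.source ∧
    ∀ y ∈ e.source, ∀ v : Tan (q + p) y,
      v ∈ tangent y ↔ ∀ a : Fin q, dFun (fun z => (e z : ModelSp (q + p)) (Fin.castAdd p a)) y v = 0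

variable {q p : ℕ} {M : Type*} [TopologicalSpace M] [ChartedSpace (ModelSp (q + p)) M]
  [IsManifold 𝓘(ℝ, ModelSp (q + p)) ∞ M]

namespace Foliation

/-- The conormal bundle `ν*F ⊆ T*M`, the dual of `νF = TM / TF`, seen as the annihilator
of `TF`. -/
def conormal (𝓕 : Foliation q p M) (x : M) : Submodule ℝ (Cot (q + p) x) where
  carrier := {ξ | ∀ v ∈ 𝓕.tangent x, ξ v = 0}
  add_mem' := fun ha hb v hv => by simp [ha v hv, hb v hv]
  zero_mem' := fun v _ => by simp
  smul_mem' := fun c ξ hξ v hv => by simp [hξ v hv]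

/-- Foliated (projectable) 1-forms over an open set `U`: smooth sections `α` of `ν*F` over `U`
such that `i(v) dα = 0` for `v` tangent to `F`. (The values outside `U` are irrelevant.) -/
def IsFoliatedForm (𝓕 : Foliation q p M) (U : Set M) (α : ∀ x, 𝓕.conormal x) : Prop :=
  SmoothOn (q + p) (CotMod (q + p)) (Cot (q + p) (M := M)) (fun x => (α x).1) U ∧
  ∀ x ∈ U, ∀ v ∈ 𝓕.tangent x, dForm (fun y => (α y).1) x v = 0

/-- Foliated (projectable) vector fields over an open set `U`: smooth vector fields `X` over `U`
whose brackets with local vector fields tangent to `F` are tangent to `F`. -/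
def IsFoliatedField (𝓕 : Foliation q p M) (U : Set M) (X : ∀ x : M, Tan (q + p) x) : Prop :=
  SmoothOn (q + p) (ModelSp (q + p)) (Tan (q + p) (M := M)) X U ∧
  ∀ (V : Set M) (Y : ∀ x : M, Tan (q + p) x), IsOpen V → V ⊆ U →
    SmoothOn (q + p) (ModelSp (q + p)) (Tan (q + p) (M := M)) Y V → (∀ x ∈ V, Y x ∈ 𝓕.tangent x) →
      ∀ x ∈ V, VectorField.mlieBracket 𝓘(ℝ, ModelSp (q + p)) X Y x ∈ 𝓕.tangent x

end Foliation

/-- A smooth vector bundle morphism `h : ν*F → TM`. -/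
structure ConormalMorphism (𝓕 : Foliation q p M) where
  toFun : ∀ x : M, 𝓕.conormal x →ₗ[ℝ] Tan (q + p) x
  smooth : IsSmoothMorphism (q + p) (CotMod (q + p)) (Cot (q + p) (M := M)) 𝓕.conormal toFun

namespace ConormalMorphism

variable {𝓕 : Foliation q p M}

/-- The map `H` induced by `h` on sections. -/
def onSec (h : ConormalMorphism 𝓕) (α : ∀ x, 𝓕.conormal x) (x : M) : Tan (q + p) x :=
  h.toFun x (α x)

open Classical in
/-- The value of `h` on a covector `ξ` that belongs to `ν*F` (and `0` on other covectors). -/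
def app (h : ConormalMorphism 𝓕) (x : M) (ξ : Cot (q + p) x) : Tan (q + p) x :=
  if hξ : ξ ∈ 𝓕.conormal x then h.toFun x ⟨ξ, hξ⟩ else 0

/-- The term `⟨K L_{Hα} β, γ⟩ + ⟨H L_{Kα} β, γ⟩` of the Gelfand-Dorfman bracket. It is used for
foliated `α, β` and for `H, K` with foliated values, and then `L_{Hα} β`, `L_{Kα} β` are again
sections of `ν*F`. -/
def gdTerm (h k : ConormalMorphism 𝓕) (α β γ : ∀ x, 𝓕.conormal x) (x : M) : ℝ :=
  (γ x).1 (k.app x (lieDeriv (h.onSec α) (fun y => (β y).1) x)) +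
    (γ x).1 (h.app x (lieDeriv (k.onSec α) (fun y => (β y).1) x))

/-- The Gelfand-Dorfman bracket `[H, K](α, β, γ)`. -/
def gdBracket (h k : ConormalMorphism 𝓕) (α β γ : ∀ x, 𝓕.conormal x) (x : M) : ℝ :=
  gdTerm h k α β γ x + gdTerm h k β γ α x + gdTerm h k γ α β x

/-- `h` is a hamiltonian structure of the foliation: over every open set, the induced map `H` on
foliated 1-forms is skew symmetric, takes values in the foliated vector fields, and satisfies the
Poisson condition `[H, H] = 0`. -/
structure IsHamiltonian (h : ConormalMorphism 𝓕) : Prop where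
  skew : ∀ (U : Set M) (α β : ∀ x, 𝓕.conormal x), IsOpen U →
    𝓕.IsFoliatedForm U α → 𝓕.IsFoliatedForm U β →
      ∀ x ∈ U, (α x).1 (h.onSec β x) = - (β x).1 (h.onSec α x)
  foliated : ∀ (U : Set M) (α : ∀ x, 𝓕.conormal x), IsOpen U →
    𝓕.IsFoliatedForm U α → 𝓕.IsFoliatedField U (h.onSec α)
  poisson : ∀ (U : Set M) (α β γ : ∀ x, 𝓕.conormal x), IsOpen U →
    𝓕.IsFoliatedForm U α → 𝓕.IsFoliatedForm U β → 𝓕.IsFoliatedForm U γ →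
      ∀ x ∈ U, gdBracket h h α β γ x = 0

end ConormalMorphism

/-- An image extension of `h`: a smooth distribution `E` with `TM = E ⊕ TF` and `im h ⊆ E`. -/
structure ImageExtension {𝓕 : Foliation q p M} (h : ConormalMorphism 𝓕) where
  fiber : ∀ x : M, Submodule ℝ (Tan (q + p) x)
  isSubbundle : IsSmoothSubbundle (q + p) (ModelSp (q + p)) (Tan (q + p) (M := M)) fiber
  isCompl : ∀ x, IsCompl (fiber x) (𝓕.tangent x)
  image_mem : ∀ (x : M) (ξ : 𝓕.conormal x), h.toFun x ξ ∈ fiber x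

namespace ImageExtension

variable {𝓕 : Foliation q p M} {h : ConormalMorphism 𝓕}

/-- `h` is tame with image extension `E`: all brackets of smooth vector fields with values in
`im h` are contained in `E`. -/
def IsTame (E : ImageExtension h) : Prop :=
  ∀ X Y : ∀ x : M, Tan (q + p) x,
    SmoothOn (q + p) (ModelSp (q + p)) (Tan (q + p) (M := M)) X univ →
    SmoothOn (q + p) (ModelSp (q + p)) (Tan (q + p) (M := M)) Y univ →
    (∀ x, X x ∈ LinearMap.range (h.toFun x)) → (∀ x, Y x ∈ LinearMap.range (h.toFun x)) →
      ∀ x, VectorField.mlieBracket 𝓘(ℝ, ModelSp (q + p)) X Y x ∈ E.fiber x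

theorem continuous_of_linear {n : ℕ} (f : ModelSp n →ₗ[ℝ] ModelSp n) : Continuous f :=
  f.continuous_of_finiteDimensional

/-- The projection `p_E : TM → TM` onto `E` along `TF`. -/
def proj (E : ImageExtension h) (x : M) : Tan (q + p) x →L[ℝ] Tan (q + p) x where
  toLinearMap := (E.fiber x).projection (𝓕.tangent x) (E.isCompl x)
  cont := continuous_of_linear (n := q + p) ((E.fiber x).projection (𝓕.tangent x) (E.isCompl x))

/-- The component `d'f` of bidegree `(1,0)` of `df`. The forms of bidegree `(1,0)` are the
sections of `ν*F`, and the `(1,0)`-component of a covector is its composition with `p_E`. -/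
def dPrimeFun (E : ImageExtension h) (f : M → ℝ) (x : M) : 𝓕.conormal x :=
  ⟨(dFun f x).comp (E.proj x), fun v hv => by
    have h0 : E.proj x v = 0 := Submodule.projection_apply_of_mem_right (E.isCompl x) hv
    simp [h0]⟩

/-- The contraction `i(v) d'α`, where `d'α(v, w) = dα(p_E v, p_E w)` is the component of bidegree
`(2,0)` of `dα`. -/
def dPrimeForm (E : ImageExtension h) (α : ∀ x, 𝓕.conormal x) (x : M) (v : Tan (q + p) x) :
    Cot (q + p) x :=
  (dForm (fun y => (α y).1) x (E.proj x v)).comp (E.proj x)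

/-- `L'_X α = i(X) d'α + d' i(X) α`, for `X` a section of `E` and `α` of bidegree `(1,0)`. -/
def lieDerivPrime (E : ImageExtension h) (X : ∀ x : M, Tan (q + p) x) (α : ∀ x, 𝓕.conormal x)
    (x : M) : Cot (q + p) x :=
  E.dPrimeForm α x (X x) + (E.dPrimeFun (fun y => (α y).1 (X y)) x).1

/-- The extended Poisson bracket `{f, g}' = X'_f g`, where `X'_f = H(d'f)`. -/
def funBracket (E : ImageExtension h) (f g : M → ℝ) (x : M) : ℝ :=
  dFun g x (h.onSec (E.dPrimeFun f) x)

/-- The extended bracket `{α, β}' = L'_{Hα} β - L'_{Hβ} α - d'⟨Hα, β⟩` of forms of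
bidegree `(1,0)`. -/
def formBracket (E : ImageExtension h) (α β : ∀ x, 𝓕.conormal x) (x : M) : Cot (q + p) x :=
  E.lieDerivPrime (h.onSec α) β x - E.lieDerivPrime (h.onSec β) α x -
    (E.dPrimeFun (fun y => (β y).1 (h.onSec α y)) x).1

/-- `P` is the bivector field of the brackets `{f, g}'`, `f, g ∈ C^∞(M)`. -/
def Induces (E : ImageExtension h) (P : BivectorField (q + p) M) : Prop :=
  ∀ (f g : C^∞⟮𝓘(ℝ, ModelSp (q + p)), M; ℝ⟯) (x : M), P.funBracket f g x = E.funBracket f g x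

end ImageExtension

end Foliations

end FoliationHamiltonian

end

/-! The projection `p_E` turns a covector `ξ` into the conormal covector `ξ ∘ p_E`; followed by `h`
this gives `♯ : T*M → TM`, the morphism of `P`. Near any point the differentials of transverse
coordinates are foliated forms that span `ν*F` pointwise. Hence skew symmetry, assumed only for
foliated forms, passes to `ν*F` by bilinearity, and then to `T*M`, since `♯` kills the annihilator
of `E` and has values in `E`. `P` is unique because differentials of global functions fill every
cotangent space.

The main point is that the Schouten bracket `S(α,β,γ) = ⟨[♯α,♯β] - ♯{α,β}_P, γ⟩` vanishes. For fixed
`α, β` it depends on `γ` only through its value at the point. Tameness puts `[♯α,♯β] - ♯{α,β}_P` in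
`E`, so only the conormal component of `γ` matters, and `γ` may be taken foliated. As `S` is cyclic,
the same holds for `α` and `β` (`IsTame.schoutenZero`). On three foliated forms the Gelfand-Dorfman
bracket `[H,H]` is `-2S`, so `S = 0` (`schouten_foliatedNear`). From `S = 0` follow the Jacobi
identity for functions, the compatibility of `♯` with brackets and the Jacobi identity for 1-forms
(`koszul_jacobi`): the cotangent Lie algebroid.

It remains to see that `ν*F` is closed under `{,}_P`. For `Y` tangent to `F` and `α, β` conormal,
`{α,β}_P(Y) = -β([♯α,Y]) - dα(♯β,Y)`. This depends on `β` pointwise, and by skewness `α` can be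
treated likewise, so both may be assumed foliated; then `[♯α,Y]` is tangent and `i(Y)dα = 0`
(`bracketForm_mem`). Finally `{α,β}'` is the conormal component of `{α,β}_P`, hence equal to it
(`formBracket_eq`). -/

noncomputable section

namespace FoliationHamiltonian

/-! ### Calculus of fields and 1-forms in the preferred chart. -/

section Calculus

variable {n : ℕ} {M : Type*} [TopologicalSpace M] [ChartedSpace (ModelSp n) M]

/-- Smoothness of a section at a point. -/
abbrev SmoothAt (n : ℕ) {M : Type*} [TopologicalSpace M] [ChartedSpace (ModelSp n) M]
    (F : Type*) [NormedAddCommGroup F] [NormedSpace ℝ F]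
    (V : M → Type*) [TopologicalSpace (TotalSpace F V)] [∀ x, TopologicalSpace (V x)]
    [FiberBundle F V] (s : ∀ x, V x) (x : M) : Prop :=
  ContMDiffAt 𝓘(ℝ, ModelSp n) (𝓘(ℝ, ModelSp n).prod 𝓘(ℝ, F)) ∞
    (fun x => TotalSpace.mk' F x (s x)) x

/-- Smoothness of a function at a point. -/
abbrev FunSmoothAt (n : ℕ) {M : Type*} [TopologicalSpace M] [ChartedSpace (ModelSp n) M]
    (f : M → ℝ) (x : M) : Prop :=
  ContMDiffAt 𝓘(ℝ, ModelSp n) 𝓘(ℝ, ℝ) ∞ f x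

variable [IsManifold 𝓘(ℝ, ModelSp n) ∞ M]

/-- Smoothness of a vector field at a point. -/
abbrev VecSmoothAt (X : ∀ x : M, Tan n x) (x : M) : Prop :=
  SmoothAt n (ModelSp n) (Tan n (M := M)) X x

/-- Smoothness of a 1-form at a point. -/
abbrev CovSmoothAt (α : ∀ x : M, Cot n x) (x : M) : Prop :=
  SmoothAt n (CotMod n) (Cot n (M := M)) α x

theorem CovSmoothAt.pair {α : ∀ x : M, Cot n x} {X : ∀ x : M, Tan n x} {x : M}
    (hα : CovSmoothAt α x) (hX : VecSmoothAt X x) : FunSmoothAt n (fun y => α y (X y)) x := by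
  have h := ContMDiffAt.clm_bundle_apply (E₂ := fun _ : M => ℝ) (F₂ := ℝ) (b := fun y => y) hα hX
  exact ((contMDiffAt_totalSpace).1 h).2

/-- The vector field on a chart domain with constant coordinates `w` in the chart at `x₀`. -/
def coordField (x₀ : M) (w : ModelSp n) (y : M) : Tan n y :=
  (trivializationAt (ModelSp n) (Tan n (M := M)) x₀).symmL ℝ y w

theorem coordField_smoothAt {x₀ x : M} (hx : x ∈ (chartAt (ModelSp n) x₀).source)
    (w : ModelSp n) : VecSmoothAt (coordField x₀ w) x := by
  set e := trivializationAt (ModelSp n) (Tan n (M := M)) x₀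
  have hs : e.baseSet = (chartAt (ModelSp n) x₀).source := TangentBundle.trivializationAt_baseSet x₀
  have : ContMDiffOn 𝓘(ℝ, ModelSp n) (𝓘(ℝ, ModelSp n).prod 𝓘(ℝ, ModelSp n)) ∞
      (fun y => TotalSpace.mk' (ModelSp n) y (coordField x₀ w y)) e.baseSet := by
    rw [e.contMDiffOn_section_baseSet_iff]
    apply (contMDiffOn_const (c := w)).congr
    intro y hy
    simp [coordField, e, e.symmL_apply hy, e.mk_symm hy, e.apply_symm_apply' hy]
  exact (this x (hs ▸ hx)).contMDiffAt (e.open_baseSet.mem_nhds (hs ▸ hx))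

theorem coordField_surjective (x : M) (v : Tan n x) : ∃ w, coordField x w x = v := by
  set e := trivializationAt (ModelSp n) (Tan n (M := M)) x
  have hx : x ∈ e.baseSet := FiberBundle.mem_baseSet_trivializationAt' x
  exact ⟨e.continuousLinearMapAt ℝ x v, e.symmL_continuousLinearMapAt hx v⟩

theorem coordField_eq {x y : M} (hy : y ∈ (chartAt (ModelSp n) x).source) (w : ModelSp n) :
    coordField x w y = mfderiv 𝓘(ℝ, ModelSp n) 𝓘(ℝ, ModelSp n)
      (extChartAt 𝓘(ℝ, ModelSp n) x).symm (extChartAt 𝓘(ℝ, ModelSp n) x y) w := by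
  unfold coordField
  rw [TangentBundle.symmL_trivializationAt hy, ModelWithCorners.range_eq_univ, mfderivWithin_univ]
  rfl

/-- In the trivialization at `x` a 1-form is the sum of its values on the coordinate frame times the
constant coordinate covectors. -/
theorem cov_smoothAt_of_coordField {α : ∀ x : M, Cot n x} {x : M}
    (h : ∀ w, FunSmoothAt n (fun y => α y (coordField x w y)) x) : CovSmoothAt α x := by
  refine (contMDiffAt_hom_bundle _).2 ⟨contMDiffAt_id, ?_⟩
  have key : ContMDiffAt 𝓘(ℝ, ModelSp n) 𝓘(ℝ, CotMod n) ∞ (fun y => ∑ i : Fin n,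
      (α y (coordField x (EuclideanSpace.single i 1) y)) • (EuclideanSpace.proj i : CotMod n)) x :=
    contMDiffAt_finsetSum fun i _ => (h _).smul contMDiffAt_const
  refine key.congr_of_eventuallyEq ?_
  filter_upwards with y
  refine ContinuousLinearMap.ext fun w => ?_
  have : w = ∑ i, w i • EuclideanSpace.single i (1 : ℝ) := by
    ext j; simp [Pi.single_apply]
  conv_lhs => rw [this]
  simp only [map_sum, map_smul]
  simp [ContinuousLinearMap.inCoordinates]
  exact Finset.sum_congr rfl fun i _ => mul_comm _ _

theorem clm_eq_sum_proj (ξ : CotMod n) :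
    ξ = ∑ i : Fin n, ξ (EuclideanSpace.single i 1) • (EuclideanSpace.proj i : CotMod n) := by
  refine ContinuousLinearMap.ext fun w => ?_
  have : w = ∑ i, w i • EuclideanSpace.single i (1 : ℝ) := by
    ext j; simp [Pi.single_apply]
  conv_lhs => rw [this]
  simp [mul_comm]

/-- The coordinate expression of a vector field in the preferred chart at `x`. -/
def chartVec (X : ∀ x : M, Tan n x) (x : M) (z : ModelSp n) : ModelSp n :=
  VectorField.mpullbackWithin 𝓘(ℝ, ModelSp n) 𝓘(ℝ, ModelSp n)
    (extChartAt 𝓘(ℝ, ModelSp n) x).symm X (range 𝓘(ℝ, ModelSp n)) z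

omit [IsManifold 𝓘(ℝ, ModelSp n) ∞ M] in
theorem extChartAt_target_nhds (x : M) : (extChartAt 𝓘(ℝ, ModelSp n) x).target ∈
    nhds (extChartAt 𝓘(ℝ, ModelSp n) x x) := extChartAt_target_mem_nhds x

theorem differentiableAt_chartVec {X : ∀ x : M, Tan n x} {x : M} (hX : VecSmoothAt X x) :
    DifferentiableAt ℝ (chartVec X x) (extChartAt 𝓘(ℝ, ModelSp n) x x) := by
  have : IsManifold 𝓘(ℝ, ModelSp n) 2 M := inferInstance
  have h := MDifferentiableWithinAt.differentiableWithinAt_mpullbackWithin_vectorField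
    (s := univ) (hX.mdifferentiableAt (by simp)).mdifferentiableWithinAt
  change DifferentiableWithinAt ℝ (chartVec X x) _ _ at h
  rwa [preimage_univ, univ_inter, ModelWithCorners.range_eq_univ,
    differentiableWithinAt_univ] at h

theorem mfderiv_extChartAt_symm_chartVec (X : ∀ x : M, Tan n x) {x : M} {z : ModelSp n}
    (hz : z ∈ (extChartAt 𝓘(ℝ, ModelSp n) x).target) :
    mfderiv 𝓘(ℝ, ModelSp n) 𝓘(ℝ, ModelSp n) (extChartAt 𝓘(ℝ, ModelSp n) x).symm z
      (chartVec X x z) = X ((extChartAt 𝓘(ℝ, ModelSp n) x).symm z) := by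
  unfold chartVec
  rw [VectorField.mpullbackWithin_apply, ModelWithCorners.range_eq_univ, mfderivWithin_univ]
  have hi := isInvertible_mfderivWithin_extChartAt_symm (I := 𝓘(ℝ, ModelSp n)) hz
  rw [ModelWithCorners.range_eq_univ, mfderivWithin_univ] at hi
  exact hi.self_apply_inverse _

theorem chartForm_chartVec (α : ∀ x : M, Cot n x) (X : ∀ x : M, Tan n x) {x : M} {z : ModelSp n}
    (hz : z ∈ (extChartAt 𝓘(ℝ, ModelSp n) x).target) :
    chartForm α x z (chartVec X x z) = α ((extChartAt 𝓘(ℝ, ModelSp n) x).symm z)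
      (X ((extChartAt 𝓘(ℝ, ModelSp n) x).symm z)) := by
  rw [← mfderiv_extChartAt_symm_chartVec X hz]
  rfl

theorem comp_extChartAt_symm_contDiffAt {f : M → ℝ} {x : M} (hf : FunSmoothAt n f x) :
    ContDiffAt ℝ ∞ (fun z => f ((extChartAt 𝓘(ℝ, ModelSp n) x).symm z))
      (extChartAt 𝓘(ℝ, ModelSp n) x x) := by
  have h1 : ContMDiffAt 𝓘(ℝ, ModelSp n) 𝓘(ℝ, ModelSp n) ∞ (extChartAt 𝓘(ℝ, ModelSp n) x).symm
      (extChartAt 𝓘(ℝ, ModelSp n) x x) :=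
    (contMDiffOn_extChartAt_symm x).contMDiffAt (extChartAt_target_nhds x)
  rw [← contMDiffAt_iff_contDiffAt]
  refine ContMDiffAt.comp (I' := 𝓘(ℝ, ModelSp n)) (g := f) _ ?_ h1
  rwa [extChartAt_to_inv]

theorem chartForm_contDiffAt {α : ∀ x : M, Cot n x} {x : M} (hα : CovSmoothAt α x) :
    ContDiffAt ℝ ∞ (chartForm α x) (extChartAt 𝓘(ℝ, ModelSp n) x x) := by
  have key : ContDiffAt ℝ ∞ (fun z : ModelSp n => ∑ i : Fin n,
      (α ((extChartAt 𝓘(ℝ, ModelSp n) x).symm z)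
        (coordField x (EuclideanSpace.single i 1) ((extChartAt 𝓘(ℝ, ModelSp n) x).symm z))) •
        (EuclideanSpace.proj i : CotMod n)) (extChartAt 𝓘(ℝ, ModelSp n) x x) :=
    ContDiffAt.sum fun i _ => (comp_extChartAt_symm_contDiffAt (f := fun y =>
      α y (coordField x (EuclideanSpace.single i 1) y))
      (hα.pair (coordField_smoothAt (mem_chart_source _ _) _))).smul contDiffAt_const
  refine key.congr_of_eventuallyEq ?_
  filter_upwards [extChartAt_target_nhds x] with z hz
  rw [clm_eq_sum_proj (chartForm α x z)]
  refine Finset.sum_congr rfl fun i _ => ?_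
  have hy : (extChartAt 𝓘(ℝ, ModelSp n) x).symm z ∈ (chartAt (ModelSp n) x).source := by
    rw [← extChartAt_source 𝓘(ℝ, ModelSp n)]
    exact (extChartAt 𝓘(ℝ, ModelSp n) x).map_target hz
  rw [coordField_eq hy, (extChartAt 𝓘(ℝ, ModelSp n) x).right_inv hz]
  rfl

/-- The tangent space at `x` is identified with the model space through the preferred chart at `x`
itself. -/
theorem chartDeriv_apply (x : M) (v : Tan n x) : chartDeriv x v = v := by
  unfold chartDeriv
  rw [mfderiv_extChartAt_self]
  rfl

theorem chartVec_self (X : ∀ x : M, Tan n x) (x : M) :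
    chartVec X x (extChartAt 𝓘(ℝ, ModelSp n) x x) = chartDeriv x (X x) := by
  rw [chartDeriv_apply]
  refine Eq.trans ?_
    (mfderivWithin_extChartAt_symm_inverse_apply (I := 𝓘(ℝ, ModelSp n)) (x := x) (X x))
  have h : (X ((extChartAt 𝓘(ℝ, ModelSp n) x).symm (extChartAt 𝓘(ℝ, ModelSp n) x x)) : ModelSp n)
    = (X x : ModelSp n) := congrArg (fun y => (X y : ModelSp n)) (extChartAt_to_inv x)
  exact congrArg (fun v : ModelSp n => (mfderivWithin 𝓘(ℝ, ModelSp n) 𝓘(ℝ, ModelSp n)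
    (extChartAt 𝓘(ℝ, ModelSp n) x).symm (range 𝓘(ℝ, ModelSp n))
      (extChartAt 𝓘(ℝ, ModelSp n) x x)).inverse v) h

theorem chartForm_self (α : ∀ x : M, Cot n x) (x : M) (v : Tan n x) :
    chartForm α x (extChartAt 𝓘(ℝ, ModelSp n) x x) (chartDeriv x v) = α x v := by
  classical
  -- Any field through `v` will do, even a discontinuous one: `chartForm_chartVec` is a pointwise
  -- identity.
  let X : ∀ y : M, Tan n y := Function.update 0 x v
  have hX : X x = v := Function.update_self ..
  have h := chartForm_chartVec α X (mem_extChartAt_target (I := 𝓘(ℝ, ModelSp n)) x)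
  rw [chartVec_self, hX] at h
  rw [h, ← hX]
  exact congrArg (fun y => α y (X y)) (extChartAt_to_inv x)

theorem dFun_eq_fderiv {f : M → ℝ} {x : M} (hf : FunSmoothAt n f x) (v : Tan n x) :
    dFun f x v = fderiv ℝ (fun z => f ((extChartAt 𝓘(ℝ, ModelSp n) x).symm z))
      (extChartAt 𝓘(ℝ, ModelSp n) x x) (chartDeriv x v) := by
  rw [chartDeriv_apply]
  unfold dFun
  rw [(hf.mdifferentiableAt (by simp)).mfderiv, ModelWithCorners.range_eq_univ, fderivWithin_univ]
  rfl

theorem chartDeriv_mlieBracket (X Y : ∀ x : M, Tan n x) (x : M) :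
    chartDeriv x (VectorField.mlieBracket 𝓘(ℝ, ModelSp n) X Y x) =
      VectorField.lieBracket ℝ (chartVec X x) (chartVec Y x)
        (extChartAt 𝓘(ℝ, ModelSp n) x x) := by
  have hi := isInvertible_mfderiv_extChartAt (I := 𝓘(ℝ, ModelSp n))
    (mem_extChartAt_source (I := 𝓘(ℝ, ModelSp n)) x)
  unfold VectorField.mlieBracket
  rw [VectorField.mlieBracketWithin_apply, preimage_univ, univ_inter]
  refine (hi.self_apply_inverse _).trans ?_
  change VectorField.lieBracketWithin ℝ (chartVec X x) (chartVec Y x) (range 𝓘(ℝ, ModelSp n)) _ = _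
  rw [ModelWithCorners.range_eq_univ, VectorField.lieBracketWithin_univ]

/-- The Leibniz rule for a pairing, in the preferred chart. -/
theorem dFun_pair {α : ∀ x : M, Cot n x} {X : ∀ x : M, Tan n x} {x : M}
    (hα : CovSmoothAt α x) (hX : VecSmoothAt X x) (v : Tan n x) :
    dFun (fun y => α y (X y)) x v =
      fderiv ℝ (chartForm α x) (extChartAt 𝓘(ℝ, ModelSp n) x x) (chartDeriv x v)
        (chartDeriv x (X x)) +
      chartForm α x (extChartAt 𝓘(ℝ, ModelSp n) x x)
        (fderiv ℝ (chartVec X x) (extChartAt 𝓘(ℝ, ModelSp n) x x) (chartDeriv x v)) := by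
  have h : (fun z => α ((extChartAt 𝓘(ℝ, ModelSp n) x).symm z)
      (X ((extChartAt 𝓘(ℝ, ModelSp n) x).symm z))) =ᶠ[nhds (extChartAt 𝓘(ℝ, ModelSp n) x x)]
      fun z => chartForm α x z (chartVec X x z) := by
    filter_upwards [extChartAt_target_nhds x] with z hz
    exact (chartForm_chartVec α X hz).symm
  rw [dFun_eq_fderiv (hα.pair hX), h.fderiv_eq,
    fderiv_clm_apply ((chartForm_contDiffAt hα).differentiableAt (by simp))
      (differentiableAt_chartVec hX), chartVec_self]
  simp [add_comm]

/-- The invariant formula for the exterior derivative of a 1-form. -/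
theorem dForm_apply {α : ∀ x : M, Cot n x} {X Y : ∀ x : M, Tan n x} {x : M}
    (hα : CovSmoothAt α x) (hX : VecSmoothAt X x) (hY : VecSmoothAt Y x) :
    dForm α x (X x) (Y x) = dFun (fun y => α y (Y y)) x (X x) - dFun (fun y => α y (X y)) x (Y x)
      - α x (VectorField.mlieBracket 𝓘(ℝ, ModelSp n) X Y x) := by
  -- By the Leibniz rule, the derivatives of the components of `X, Y` assemble to the bracket, and
  -- those of `α` to `dα`.
  rw [dFun_pair hα hX, dFun_pair hα hY, ← chartForm_self α x (VectorField.mlieBracket _ _ _ _),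
    chartDeriv_mlieBracket, VectorField.lieBracket, map_sub, chartVec_self, chartVec_self]
  simp only [dForm, _root_.sub_apply, ContinuousLinearMap.comp_apply,
    ContinuousLinearMap.apply_apply]
  ring

/-- The equality is needed near the point and not only at it, because `dForm` differentiates the
chart expression. -/
theorem chartForm_dFun {f : M → ℝ} {x : M} (hf : FunSmoothAt n f x) :
    chartForm (dFun f) x =ᶠ[nhds (extChartAt 𝓘(ℝ, ModelSp n) x x)]
      fderiv ℝ (fun z => f ((extChartAt 𝓘(ℝ, ModelSp n) x).symm z)) := by
  have h1 : ∀ᶠ y in nhds x, ContMDiffAt 𝓘(ℝ, ModelSp n) 𝓘(ℝ, ℝ) 1 f y :=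
    contMDiffAt_iff_contMDiffAt_nhds (by simp) |>.1 (ContMDiffAt.of_le hf (by norm_cast))
  have h2 : ContinuousAt (extChartAt 𝓘(ℝ, ModelSp n) x).symm (extChartAt 𝓘(ℝ, ModelSp n) x x) :=
    continuousAt_extChartAt_symm x
  have h3 := h2.eventually (p := fun y => ContMDiffAt 𝓘(ℝ, ModelSp n) 𝓘(ℝ, ℝ) 1 f y)
    (by rwa [extChartAt_to_inv])
  filter_upwards [h3, extChartAt_target_nhds x] with z hz hz2
  have h4 : MDifferentiableAt 𝓘(ℝ, ModelSp n) 𝓘(ℝ, ModelSp n)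
      (extChartAt 𝓘(ℝ, ModelSp n) x).symm z :=
    ((contMDiffOn_extChartAt_symm (n := ∞) x).contMDiffAt
      ((isOpen_extChartAt_target x).mem_nhds hz2)).mdifferentiableAt (by simp)
  have h5 := mfderiv_comp (I' := 𝓘(ℝ, ModelSp n)) z (hz.mdifferentiableAt (by simp)) h4
  rw [← mfderiv_eq_fderiv]
  exact h5.symm

theorem dFun_smoothAt {f : M → ℝ} {x : M} (hf : FunSmoothAt n f x) : CovSmoothAt (dFun (n := n) f) x := by
  refine cov_smoothAt_of_coordField fun w => ?_
  have h1 : ContDiffAt ℝ ∞ (fun z => fderiv ℝ (fun z => f ((extChartAt 𝓘(ℝ, ModelSp n) x).symm z))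
      z w) (extChartAt 𝓘(ℝ, ModelSp n) x x) :=
    ((comp_extChartAt_symm_contDiffAt hf).fderiv_right (m := ∞) (by simp)).clm_apply
      contDiffAt_const
  have h2 : FunSmoothAt n (fun y => fderiv ℝ (fun z => f ((extChartAt 𝓘(ℝ, ModelSp n) x).symm z))
      (extChartAt 𝓘(ℝ, ModelSp n) x y) w) x :=
    ContMDiffAt.comp x h1.contMDiffAt contMDiffAt_extChartAt
  refine h2.congr_of_eventuallyEq ?_
  filter_upwards [(continuousAt_extChartAt x).eventually (chartForm_dFun hf),
    (chartAt (ModelSp n) x).open_source.mem_nhds (mem_chart_source _ x)] with y hy hy2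
  rw [coordField_eq hy2, ← hy]
  have h3 : (extChartAt 𝓘(ℝ, ModelSp n) x).symm (extChartAt 𝓘(ℝ, ModelSp n) x y) = y :=
    (extChartAt 𝓘(ℝ, ModelSp n) x).left_inv (by simpa using hy2)
  unfold chartForm
  exact congrArg (fun u => (dFun f u : CotMod n) (mfderiv 𝓘(ℝ, ModelSp n) 𝓘(ℝ, ModelSp n)
    (extChartAt 𝓘(ℝ, ModelSp n) x).symm (extChartAt 𝓘(ℝ, ModelSp n) x y) w)) h3.symm

/-- In the chart, `d² = 0` is the symmetry of the second derivative. -/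
theorem dForm_dFun {f : M → ℝ} {x : M} (hf : FunSmoothAt n f x) (v : Tan n x) :
    dForm (dFun f) x v = 0 := by
  have hs : IsSymmSndFDerivAt ℝ (fun z => f ((extChartAt 𝓘(ℝ, ModelSp n) x).symm z))
      (extChartAt 𝓘(ℝ, ModelSp n) x x) :=
    (comp_extChartAt_symm_contDiffAt hf).isSymmSndFDerivAt (by simp; norm_cast)
  refine ContinuousLinearMap.ext fun w => ?_
  simp only [dForm, _root_.sub_apply, ContinuousLinearMap.comp_apply,
    ContinuousLinearMap.apply_apply, (chartForm_dFun hf).fderiv_eq]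
  rw [hs.eq]
  exact sub_self _

theorem dFun_mlieBracket {f : M → ℝ} {X Y : ∀ x : M, Tan n x} {x : M}
    (hf : FunSmoothAt n f x) (hX : VecSmoothAt X x) (hY : VecSmoothAt Y x) :
    dFun f x (VectorField.mlieBracket 𝓘(ℝ, ModelSp n) X Y x) =
      dFun (fun y => dFun f y (Y y)) x (X x) - dFun (fun y => dFun f y (X y)) x (Y x) := by
  have h := dForm_apply (dFun_smoothAt hf) hX hY
  rw [dForm_dFun hf] at h
  have h0 : (0 : Cot n x) (Y x) = 0 := rfl
  rw [h0] at h
  linarith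

omit [IsManifold 𝓘(ℝ, ModelSp n) ∞ M] in
theorem dForm_congr {α β : ∀ x : M, Cot n x} {x : M} (h : ∀ᶠ y in nhds x, α y = β y) :
    dForm α x = dForm β x := by
  have h2 : chartForm α x =ᶠ[nhds (extChartAt 𝓘(ℝ, ModelSp n) x x)] chartForm β x := by
    have h3 : ContinuousAt (extChartAt 𝓘(ℝ, ModelSp n) x).symm
      (extChartAt 𝓘(ℝ, ModelSp n) x x) := continuousAt_extChartAt_symm x
    filter_upwards [h3.eventually (p := fun y => α y = β y) (by rwa [extChartAt_to_inv])] with z hz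
    unfold chartForm
    rw [hz]
  unfold dForm
  rw [h2.fderiv_eq]

end Calculus

/-! ### Extension of germs to global objects by cutoff functions. -/

section Extension

variable {n : ℕ} {M : Type*} [TopologicalSpace M] [T2Space M] [ChartedSpace (ModelSp n) M]
  [IsManifold 𝓘(ℝ, ModelSp n) ∞ M]

theorem exists_cutoff {x : M} {U : Set M} (hU : U ∈ nhds x) :
    ∃ ρ : M → ℝ, (∀ y, FunSmoothAt n ρ y) ∧ (∀ᶠ y in nhds x, ρ y = 1) ∧ tsupport ρ ⊆ U := by
  obtain ⟨ρ, -, hρ⟩ :=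
    (SmoothBumpFunction.nhds_basis_tsupport (I := 𝓘(ℝ, ModelSp n)) x).mem_iff.1 hU
  exact ⟨ρ, fun y => ρ.contMDiff y, ρ.eventuallyEq_one, hρ⟩

theorem exists_fun_germ {x : M} {U : Set M} (hU : IsOpen U) (hx : x ∈ U) {g : M → ℝ}
    (hg : ∀ y ∈ U, FunSmoothAt n g y) :
    ∃ f : C^∞⟮𝓘(ℝ, ModelSp n), M; ℝ⟯, ∀ᶠ y in nhds x, f y = g y := by
  obtain ⟨ρ, h0, h1, h2⟩ := exists_cutoff (n := n) (hU.mem_nhds hx)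
  refine ⟨⟨fun y => ρ y * g y, fun y => ?_⟩, ?_⟩
  · by_cases hy : y ∈ U
    · exact (h0 y).mul (hg y hy)
    · have h3 : y ∉ tsupport ρ := fun h => hy (h2 h)
      refine (contMDiffAt_const (c := (0 : ℝ))).congr_of_eventuallyEq ?_
      filter_upwards [notMem_tsupport_iff_eventuallyEq.1 h3] with z hz
      simp [hz]
  · filter_upwards [h1] with y hy
    change ρ y * g y = g y
    rw [hy, one_mul]

/-- Lets the algebra be done with global sections only: a local section is replaced by a global one
with the same germ. -/
theorem exists_section_germ {F : Type*} [NormedAddCommGroup F] [NormedSpace ℝ F]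
    {V : M → Type*} [TopologicalSpace (TotalSpace F V)] [∀ x, TopologicalSpace (V x)]
    [FiberBundle F V] [∀ x, AddCommGroup (V x)] [∀ x, Module ℝ (V x)] [VectorBundle ℝ F V]
    {x : M} {U : Set M} (hU : IsOpen U) (hx : x ∈ U) {s : ∀ y, V y}
    (hs : ∀ y ∈ U, SmoothAt n F V s y) :
    ∃ t : Cₛ^∞⟮𝓘(ℝ, ModelSp n); F, V⟯, ∀ᶠ y in nhds x, t y = s y := by
  obtain ⟨ρ, h0, h1, h2⟩ := exists_cutoff (n := n) (hU.mem_nhds hx)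
  refine ⟨⟨fun y => ρ y • s y, fun y => ?_⟩, ?_⟩
  · by_cases hy : y ∈ U
    · exact (h0 y).smul_section (hs y hy)
    · have h3 : y ∉ tsupport ρ := fun h => hy (h2 h)
      refine (contMDiff_zeroSection ℝ V y).congr_of_eventuallyEq ?_
      filter_upwards [notMem_tsupport_iff_eventuallyEq.1 h3] with z hz
      simp [hz, zeroSection]
  · filter_upwards [h1] with y hy
    change ρ y • s y = s y
    rw [hy, one_smul]

end Extension

/-! ### The algebra of global functions, vector fields and 1-forms. -/

section Bundled

variable (n : ℕ) (M : Type*) [TopologicalSpace M] [ChartedSpace (ModelSp n) M]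
  [IsManifold 𝓘(ℝ, ModelSp n) ∞ M]

/-- Smooth functions on `M`. -/
abbrev Fn : Type _ := C^∞⟮𝓘(ℝ, ModelSp n), M; ℝ⟯

/-- Smooth vector fields on `M`. -/
abbrev Vec : Type _ := Cₛ^∞⟮𝓘(ℝ, ModelSp n); ModelSp n, Tan n (M := M)⟯

/-- Smooth 1-forms on `M`. -/
abbrev Form : Type _ := Cₛ^∞⟮𝓘(ℝ, ModelSp n); CotMod n, Cot n (M := M)⟯

variable {n M}

theorem exists_vec [T2Space M] (x : M) (v : Tan n x) : ∃ X : Vec n M, X x = v := by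
  obtain ⟨w, hw⟩ := coordField_surjective x v
  obtain ⟨X, hX⟩ := exists_section_germ (n := n) (F := ModelSp n) (V := Tan n (M := M))
    (chartAt (ModelSp n) x).open_source
    (mem_chart_source _ x) (s := coordField x w) fun y hy => coordField_smoothAt hy w
  exact ⟨X, by rw [hX.self_of_nhds, hw]⟩

omit [IsManifold 𝓘(ℝ, ModelSp n) ∞ M] in
theorem cot_ext {x : M} {ξ η : Cot n x} (h : ∀ v, ξ v = η v) : ξ = η := ContinuousLinearMap.ext h

omit [IsManifold 𝓘(ℝ, ModelSp n) ∞ M] in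
theorem tan_ext {x : M} {v w : Tan n x} (h : ∀ ξ : Cot n x, ξ v = ξ w) : v = w := by
  refine PiLp.ext fun i => ?_
  exact h (EuclideanSpace.proj i : CotMod n)

omit [IsManifold 𝓘(ℝ, ModelSp n) ∞ M] in
theorem dFun_congr {f g : M → ℝ} {x : M} (h : ∀ᶠ y in nhds x, f y = g y) :
    dFun (n := n) f x = dFun g x := by
  have h2 := Filter.EventuallyEq.mfderiv_eq (I := 𝓘(ℝ, ModelSp n)) (I' := 𝓘(ℝ, ℝ)) h
  exact h2

/-- A linear function of the chart at `x`, cut off, has the prescribed differential. This makes a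
bivector field determined by its bracket of functions. -/
theorem exists_fun_dFun [T2Space M] (x : M) (ξ : Cot n x) : ∃ f : Fn n M, dFun f x = ξ := by
  let η : CotMod n := ξ
  obtain ⟨f, hf⟩ := exists_fun_germ (n := n) (chartAt (ModelSp n) x).open_source
    (mem_chart_source _ x) (g := fun y => η (extChartAt 𝓘(ℝ, ModelSp n) x y)) fun y hy =>
      ContMDiffAt.comp y η.contMDiff.contMDiffAt (contMDiffAt_extChartAt' hy)
  refine ⟨f, cot_ext fun v => ?_⟩
  have hs : FunSmoothAt n (fun y => η (extChartAt 𝓘(ℝ, ModelSp n) x y)) x :=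
    ContMDiffAt.comp x η.contMDiff.contMDiffAt contMDiffAt_extChartAt
  rw [dFun_congr hf, dFun_eq_fderiv hs, chartDeriv_apply]
  have : (fun z => η (extChartAt 𝓘(ℝ, ModelSp n) x ((extChartAt 𝓘(ℝ, ModelSp n) x).symm z)))
      =ᶠ[nhds (extChartAt 𝓘(ℝ, ModelSp n) x x)] η := by
    filter_upwards [extChartAt_target_nhds x] with z hz
    rw [(extChartAt 𝓘(ℝ, ModelSp n) x).right_inv hz]
  rw [this.fderiv_eq, η.fderiv]
  rfl

/-- Gives the smoothness of brackets of 1-forms, which are known through their values on global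
fields. -/
theorem cov_smooth_of_vec [T2Space M] {α : ∀ x : M, Cot n x}
    (h : ∀ X : Vec n M, ∀ x, FunSmoothAt n (fun y => α y (X y)) x) (x : M) : CovSmoothAt α x := by
  refine cov_smoothAt_of_coordField fun w => ?_
  obtain ⟨X, hX⟩ := exists_section_germ (n := n) (F := ModelSp n) (V := Tan n (M := M))
    (chartAt (ModelSp n) x).open_source
    (mem_chart_source _ x) (s := coordField x w) fun y hy => coordField_smoothAt hy w
  refine (h X x).congr_of_eventuallyEq ?_
  filter_upwards [hX] with y hy
  rw [hy]

/-- The pairing of a 1-form and a vector field. -/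
def pair (α : Form n M) (X : Vec n M) : Fn n M :=
  ⟨fun y => α y (X y), fun x => CovSmoothAt.pair (α.contMDiff x) (X.contMDiff x)⟩

/-- The differential of a function. -/
def dif (f : Fn n M) : Form n M := ⟨dFun f, fun x => dFun_smoothAt (f.contMDiff x)⟩

/-- The derivative of a function along a vector field. -/
def der (X : Vec n M) (f : Fn n M) : Fn n M := pair (dif f) X

/-- The Lie bracket of vector fields. -/
def lie (X Y : Vec n M) : Vec n M :=
  ⟨VectorField.mlieBracket 𝓘(ℝ, ModelSp n) X Y, fun x =>
    have : IsManifold 𝓘(ℝ, ModelSp n) (∞ + 1) M := inferInstanceAs (IsManifold _ ∞ M)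
    have : IsManifold 𝓘(ℝ, ModelSp n) (minSmoothness ℝ 2) M := by
      rw [minSmoothness_of_isRCLikeNormedField]; infer_instance
    ContMDiffAt.mlieBracket_vectorField (n := ⊤) (m := ⊤) (X.contMDiff x) (Y.contMDiff x) (by simp)⟩

@[simp] theorem pair_apply (α : Form n M) (X : Vec n M) (x : M) : pair α X x = α x (X x) := rfl
@[simp] theorem dif_apply (f : Fn n M) (x : M) : dif f x = dFun f x := rfl
theorem der_apply (X : Vec n M) (f : Fn n M) (x : M) : der X f x = dFun f x (X x) := rfl
theorem lie_apply (X Y : Vec n M) (x : M) :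
    lie X Y x = VectorField.mlieBracket 𝓘(ℝ, ModelSp n) X Y x := rfl
theorem pair_dif (f : Fn n M) (X : Vec n M) : pair (dif f) X = der X f := rfl

theorem pair_add (α : Form n M) (X Y : Vec n M) : pair α (X + Y) = pair α X + pair α Y := by
  ext x; simp
theorem pair_neg (α : Form n M) (X : Vec n M) : pair α (-X) = -pair α X := by
  ext x; simp
theorem pair_smul (α : Form n M) (c : ℝ) (X : Vec n M) : pair α (c • X) = c • pair α X := by
  ext x; simp
theorem add_pair (α β : Form n M) (X : Vec n M) : pair (α + β) X = pair α X + pair β X := by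
  ext x; simp
theorem smul_pair (c : ℝ) (α : Form n M) (X : Vec n M) : pair (c • α) X = c • pair α X := by
  ext x; simp

theorem der_lie (X Y : Vec n M) (f : Fn n M) :
    der (lie X Y) f = der X (der Y f) - der Y (der X f) := by
  ext x
  exact dFun_mlieBracket (f.contMDiff x) (X.contMDiff x) (Y.contMDiff x)

omit [IsManifold 𝓘(ℝ, ModelSp n) ∞ M] in
theorem dFun_add {f g : M → ℝ} {x : M} (hf : FunSmoothAt n f x) (hg : FunSmoothAt n g x) :
    dFun (n := n) (f + g) x = dFun f x + dFun g x :=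
  mfderiv_add (hf.mdifferentiableAt (by simp)) (hg.mdifferentiableAt (by simp))

omit [IsManifold 𝓘(ℝ, ModelSp n) ∞ M] in
theorem dFun_mul {f g : M → ℝ} {x : M} (hf : FunSmoothAt n f x) (hg : FunSmoothAt n g x) :
    dFun (n := n) (f * g) x = f x • dFun g x + g x • dFun f x := by
  have := ((hf.mdifferentiableAt (by simp)).hasMFDerivAt.mul
    (hg.mdifferentiableAt (by simp)).hasMFDerivAt).mfderiv
  exact this

theorem der_add (X : Vec n M) (f g : Fn n M) : der X (f + g) = der X f + der X g := by
  ext x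
  simp only [der_apply, ContMDiffMap.coe_add, dFun_add (f.contMDiff x) (g.contMDiff x)]
  rfl

theorem der_mul (X : Vec n M) (f g : Fn n M) : der X (f * g) = f * der X g + g * der X f := by
  ext x
  simp only [der_apply, ContMDiffMap.coe_mul, dFun_mul (f.contMDiff x) (g.contMDiff x)]
  rfl

theorem add_der (X Y : Vec n M) (f : Fn n M) : der (X + Y) f = der X f + der Y f :=
  pair_add _ _ _

theorem lie_skew (X Y : Vec n M) : lie X Y = - lie Y X := by
  ext x : 1; exact VectorField.mlieBracket_swap_apply
theorem lie_add (X Y Z : Vec n M) : lie X (Y + Z) = lie X Y + lie X Z := by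
  ext x : 1
  exact VectorField.mlieBracket_add_right ((Y.contMDiff x).mdifferentiableAt (by simp))
    ((Z.contMDiff x).mdifferentiableAt (by simp))

theorem lie_jacobi (X Y Z : Vec n M) : lie X (lie Y Z) = lie (lie X Y) Z + lie Y (lie X Z) := by
  have : IsManifold 𝓘(ℝ, ModelSp n) (minSmoothness ℝ 3) M := by
    rw [minSmoothness_of_isRCLikeNormedField]; infer_instance
  ext x : 1
  have h : ∀ W : Vec n M, ContMDiff 𝓘(ℝ, ModelSp n) (𝓘(ℝ, ModelSp n).tangent) (minSmoothness ℝ 2)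
      (fun x => (⟨x, W x⟩ : TangentBundle 𝓘(ℝ, ModelSp n) M)) := fun W =>
    W.contMDiff.of_le (by rw [minSmoothness_of_isRCLikeNormedField]; norm_cast)
  exact congrFun (VectorField.leibniz_identity_mlieBracket (h X) (h Y) (h Z)) x

theorem lie_mul_apply (X Y Z : Vec n M) (f : Fn n M) (hZ : ∀ x, Z x = f x • Y x) (x : M) :
    lie X Z x = f x • lie X Y x + der X f x • Y x := by
  have h := VectorField.mlieBracket_smul_right (I := 𝓘(ℝ, ModelSp n)) (V := X) (W := Y) (f := f)
    (x := x) ((f.contMDiff x).mdifferentiableAt (by simp))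
    ((Y.contMDiff x).mdifferentiableAt (by simp))
  have hZ' : (Z : ∀ y : M, Tan n y) = (f : M → ℝ) • (Y : ∀ y : M, Tan n y) := funext hZ
  rw [lie_apply, hZ', h, add_comm]
  rfl

end Bundled

/-! ### The Koszul and Schouten expressions and the Jacobi identity. -/

section Poisson

variable {n : ℕ} {M : Type*} [TopologicalSpace M] [ChartedSpace (ModelSp n) M]
  [IsManifold 𝓘(ℝ, ModelSp n) ∞ M]

theorem pair_sub (α : Form n M) (X Y : Vec n M) : pair α (X - Y) = pair α X - pair α Y := by
  ext x; simp

theorem der_neg (X : Vec n M) (f : Fn n M) : der X (-f) = -der X f := by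
  have h := der_add X f (-f)
  have h0 : der X (0 : Fn n M) = 0 := by simpa using der_add X 0 0
  rw [add_neg_cancel, h0] at h
  linear_combination -h

theorem der_sub (X : Vec n M) (f g : Fn n M) : der X (f - g) = der X f - der X g := by
  rw [sub_eq_add_neg, der_add, der_neg, sub_eq_add_neg]

/-- In Cartan's formula the term `d(i(X)α)(W)` cancels against the same term of `dα(X, W)`. -/
theorem lieDeriv_apply (X : Vec n M) (α : Form n M) (W : Vec n M) (x : M) :
    lieDeriv X α x (W x) = (der X (pair α W) - pair α (lie X W)) x := by
  have h := dForm_apply (α.contMDiff x) (X.contMDiff x) (W.contMDiff x)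
  unfold lieDeriv
  rw [_root_.add_apply, h]
  simp only [ContMDiffMap.coe_sub, Pi.sub_apply, der_apply, pair_apply, lie_apply]
  change _ + (_ - dFun (pair α X) x (W x) - _) = _
  change dFun (pair α X) x (W x) + _ = _
  change _ + (dFun (pair α W) x (X x) - _ - _) = _
  ring

theorem form_ext [T2Space M] {α β : Form n M} (h : ∀ W, pair α W = pair β W) : α = β := by
  ext x : 1
  refine cot_ext fun v => ?_
  obtain ⟨W, rfl⟩ := exists_vec x v
  exact congrArg (fun f : Fn n M => f x) (h W)

theorem vec_ext [T2Space M] {X Y : Vec n M} (h : ∀ α : Form n M, pair α X = pair α Y) : X = Y := by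
  ext x : 1
  refine tan_ext fun ξ => ?_
  obtain ⟨f, rfl⟩ := exists_fun_dFun x ξ
  exact congrArg (fun f : Fn n M => f x) (h (dif f))

/-- The bracket of the 1-forms `α, β` associated with the fields `A = ♯α`, `B = ♯β`, evaluated
on a field `W`. -/
def koszul (α : Form n M) (A : Vec n M) (β : Form n M) (B W : Vec n M) : Fn n M :=
  der A (pair β W) - pair β (lie A W) - der B (pair α W) + der W (pair α B) + pair α (lie B W)

/-- Half of the Schouten bracket of a bivector field with itself, on three 1-forms. -/
def schouten (α : Form n M) (A : Vec n M) (β : Form n M) (B : Vec n M) (γ : Form n M)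
    (C : Vec n M) : Fn n M :=
  pair γ (lie A B) + pair α (lie B C) + pair β (lie C A) +
    der A (pair β C) + der B (pair γ A) + der C (pair α B)

theorem der_zero (X : Vec n M) : der X (0 : Fn n M) = 0 := by
  simpa using der_add X 0 0

/-- A formal identity between fields and forms: no bivector is present, only fields `A, B, C` in the
role of `♯α, ♯β, ♯γ`, with `[A,B]`, `[B,C]`, `[C,A]` in that of the anchors of the brackets. -/
theorem koszul_jacobi {α β γ ab bc ca : Form n M} {A B C : Vec n M} 
    (hab : ∀ W, pair ab W = koszul α A β B W) (hbc : ∀ W, pair bc W = koszul β B γ C W)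
    (hca : ∀ W, pair ca W = koszul γ C α A W)
    (h1 : pair α B = - pair β A) (h2 : pair β C = - pair γ B) (h3 : pair γ A = - pair α C)
    (hJ : schouten α A β B γ C = 0) (W : Vec n M) :
    koszul ab (lie A B) γ C W + koszul bc (lie B C) α A W + koszul ca (lie C A) β B W = 0 := by
  have hJ' := congrArg (der W) hJ
  have j1 := congrArg (pair γ) (lie_jacobi A B W)
  have j2 := congrArg (pair α) (lie_jacobi B C W)
  have j3 := congrArg (pair β) (lie_jacobi C A W)
  simp only [pair_add] at j1 j2 j3
  simp only [schouten, koszul, hab, hbc, hca, h1, h2, h3, lie_skew A C, lie_skew B A, lie_skew C B,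
    pair_neg, der_neg, der_add, der_sub, der_lie, der_zero] at hJ' ⊢
  -- The cyclic sum is twice the derivative along `W` of the Schouten expression, up to the Jacobi
  -- identities of `(A,B,W)`, `(B,C,W)`, `(C,A,W)` paired with `γ`, `α`, `β`.
  linear_combination 2 * hJ' + j1 + j2 + j3

end Poisson

/-! ### The bracket of 1-forms of a bivector field with vanishing Schouten bracket. -/

namespace BivectorField

variable {n : ℕ} {M : Type*} [TopologicalSpace M] [ChartedSpace (ModelSp n) M]
  [IsManifold 𝓘(ℝ, ModelSp n) ∞ M] (P : BivectorField n M)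

/-- The vector field `♯_P α`. -/
def sharpForm (α : Form n M) : Vec n M :=
  ⟨fun x => P.sharp x (α x),
    contMDiffOn_univ.1 (P.smooth univ α isOpen_univ (contMDiffOn_univ.2 α.contMDiff))⟩

theorem sharpForm_apply (α : Form n M) (x : M) : P.sharpForm α x = P.sharp x (α x) := rfl

theorem pair_sharpForm (α β : Form n M) : pair β (P.sharpForm α) = - pair α (P.sharpForm β) := by
  ext x
  exact P.skew x (α x) (β x)

theorem formBracket_apply (α β : Form n M) (W : Vec n M) (x : M) :
    P.formBracket α β x (W x) = koszul α (P.sharpForm α) β (P.sharpForm β) W x := by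
  unfold formBracket
  change (lieDeriv (P.sharpForm α) β x - lieDeriv (P.sharpForm β) α x -
    dFun (pair β (P.sharpForm α)) x : Cot n x) (W x) = _
  rw [_root_.sub_apply, _root_.sub_apply, lieDeriv_apply, lieDeriv_apply, ← der_apply,
    pair_sharpForm, der_neg]
  simp only [koszul, ContMDiffMap.coe_sub, ContMDiffMap.coe_add, Pi.sub_apply, Pi.add_apply, ContMDiffMap.coe_neg, Pi.neg_apply]
  ring

variable [T2Space M]

/-- The 1-form `{α, β}_P`. -/
def bracketForm (α β : Form n M) : Form n M :=
  ⟨P.formBracket α β, cov_smooth_of_vec fun W x => by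
    simp only [formBracket_apply]
    exact (koszul α (P.sharpForm α) β (P.sharpForm β) W).contMDiff x⟩

theorem pair_bracketForm (α β : Form n M) (W : Vec n M) :
    pair (P.bracketForm α β) W = koszul α (P.sharpForm α) β (P.sharpForm β) W := by
  ext x
  exact P.formBracket_apply α β W x

/-- The vanishing of the Schouten bracket of `P` with itself. -/
def SchoutenZero : Prop := ∀ α β γ : Form n M,
  schouten α (P.sharpForm α) β (P.sharpForm β) γ (P.sharpForm γ) = 0

variable {P}

/-- Paired with an arbitrary `γ`, the difference of the two sides is the Schouten expression, up to
sign. -/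
theorem SchoutenZero.sharpForm_bracketForm (hP : P.SchoutenZero) (α β : Form n M) :
    P.sharpForm (P.bracketForm α β) = lie (P.sharpForm α) (P.sharpForm β) := by
  refine vec_ext fun γ => ?_
  have h := hP α β γ
  rw [pair_sharpForm, pair_bracketForm]
  unfold koszul
  unfold schouten at h
  rw [P.pair_sharpForm α γ, lie_skew (P.sharpForm γ), pair_neg, der_neg] at h
  linear_combination -h

theorem SchoutenZero.jacobi (hP : P.SchoutenZero) (α β γ : Form n M) :
    P.bracketForm (P.bracketForm α β) γ + P.bracketForm (P.bracketForm β γ) α +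
      P.bracketForm (P.bracketForm γ α) β = 0 := by
  refine form_ext fun W => ?_
  have h0 : pair (0 : Form n M) W = 0 := by ext x; rfl
  simp only [add_pair, pair_bracketForm, hP.sharpForm_bracketForm, h0]
  exact koszul_jacobi (P.pair_bracketForm α β) (P.pair_bracketForm β γ) (P.pair_bracketForm γ α)
    (P.pair_sharpForm _ _) (P.pair_sharpForm _ _) (P.pair_sharpForm _ _) (hP α β γ) W

omit [T2Space M] in
-- On exact forms `df, dg, dk` the Schouten expression is, up to sign, the Jacobiator of the
-- functions, once the commutators are expanded as iterated derivatives.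
theorem SchoutenZero.isPoisson (hP : P.SchoutenZero) : P.IsPoisson := by
  intro f g k x
  have key : ∀ u v : Fn n M, P.funBracket u v = (der (P.sharpForm (dif u)) v : Fn n M) :=
    fun u v => rfl
  have hs : ∀ u v : Fn n M, der (P.sharpForm (dif u)) v = - der (P.sharpForm (dif v)) u :=
    fun u v => P.pair_sharpForm _ _
  have h := hP (dif f) (dif g) (dif k)
  simp only [key]
  change (der (P.sharpForm (dif (der (P.sharpForm (dif f)) g))) k +
    der (P.sharpForm (dif (der (P.sharpForm (dif g)) k))) f +
    der (P.sharpForm (dif (der (P.sharpForm (dif k)) f))) g) x = (0 : Fn n M) x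
  congr 1
  simp only [schouten, pair_dif, der_lie] at h
  rw [hs (der _ g) k, hs (der _ k) f, hs (der _ f) g]
  rw [hs g f, hs k g, hs f k] at h
  simp only [der_neg] at h
  linear_combination -h

end BivectorField

/-! ### The whole bundle as a subbundle; linearity over the reals. -/

section Cotangent

variable {n : ℕ} {M : Type*} [TopologicalSpace M] [ChartedSpace (ModelSp n) M]

theorem isSmoothSubbundle_top (F : Type*) [NormedAddCommGroup F] [NormedSpace ℝ F]
    [FiniteDimensional ℝ F] (V : M → Type*) [TopologicalSpace (TotalSpace F V)]
    [∀ x, TopologicalSpace (V x)] [FiberBundle F V] [∀ x, AddCommGroup (V x)]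
    [∀ x, Module ℝ (V x)] [VectorBundle ℝ F V]
    [ContMDiffVectorBundle ∞ F V 𝓘(ℝ, ModelSp n)] :
    IsSmoothSubbundle n F V (fun _ => ⊤) := by
  intro x
  have hf := (trivializationAt F V x).isLocalFrameOn_localFrame_baseSet 𝓘(ℝ, ModelSp n) ∞
    (Module.finBasis ℝ F)
  exact ⟨_, (trivializationAt F V x).open_baseSet, FiberBundle.mem_baseSet_trivializationAt' x,
    _, _, hf.contMDiffOn, fun y hy => ⟨hf.linearIndependent hy, top_le_iff.1 (hf.generating hy)⟩⟩

variable [IsManifold 𝓘(ℝ, ModelSp n) ∞ M]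

theorem der_smul (X : Vec n M) (c : ℝ) (f : Fn n M) : der X (c • f) = c • der X f := by
  ext x
  have h := const_smul_mfderiv (I := 𝓘(ℝ, ModelSp n)) ((f.contMDiff x).mdifferentiableAt (by simp)) c
  exact congrArg (fun ξ : Cot n x => ξ (X x)) h

theorem smul_der (X : Vec n M) (c : ℝ) (f : Fn n M) : der (c • X) f = c • der X f :=
  pair_smul _ _ _

theorem lie_smul (X Y : Vec n M) (c : ℝ) : lie X (c • Y) = c • lie X Y := by
  ext x : 1
  exact VectorField.mlieBracket_const_smul_right ((Y.contMDiff x).mdifferentiableAt (by simp))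

theorem add_lie (X Y Z : Vec n M) : lie (X + Y) Z = lie X Z + lie Y Z := by
  rw [lie_skew, lie_add, neg_add, ← lie_skew, ← lie_skew]

theorem smul_lie (X Y : Vec n M) (c : ℝ) : lie (c • X) Y = c • lie X Y := by
  rw [lie_skew, lie_smul, ← smul_neg, ← lie_skew]

end Cotangent

/-! ### From vanishing Schouten bracket to Lie algebroids. -/

namespace BivectorField

variable {n : ℕ} {M : Type*} [TopologicalSpace M] [ChartedSpace (ModelSp n) M]
  [IsManifold 𝓘(ℝ, ModelSp n) ∞ M] (P : BivectorField n M)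

theorem sharpForm_add (α β : Form n M) :
    P.sharpForm (α + β) = P.sharpForm α + P.sharpForm β := by
  ext x : 1
  exact map_add (P.sharp x) _ _

theorem sharpForm_smul (c : ℝ) (α : Form n M) : P.sharpForm (c • α) = c • P.sharpForm α := by
  ext x : 1
  exact map_smul (P.sharp x) _ _

variable [T2Space M]

theorem bracketForm_skew (α β : Form n M) : P.bracketForm α β = - P.bracketForm β α := by
  refine form_ext fun W => ?_
  have h0 : pair (-P.bracketForm β α) W = - pair (P.bracketForm β α) W := by
    ext x; simp
  rw [h0, pair_bracketForm, pair_bracketForm, koszul, koszul, P.pair_sharpForm α β, der_neg]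
  ring

theorem bracketForm_add (α β γ : Form n M) :
    P.bracketForm α (β + γ) = P.bracketForm α β + P.bracketForm α γ := by
  refine form_ext fun W => ?_
  simp only [add_pair, pair_bracketForm, koszul, sharpForm_add, pair_add, der_add, add_der, add_lie]
  ring

theorem bracketForm_smul (c : ℝ) (α β : Form n M) :
    P.bracketForm α (c • β) = c • P.bracketForm α β := by
  refine form_ext fun W => ?_
  simp only [smul_pair, pair_bracketForm, koszul, sharpForm_smul, pair_smul, der_smul, smul_der,
    smul_lie, smul_add, smul_sub]

/-- The factor `f` passes through `♯`; the two terms with `W f`, from `W(α(f♯β))` and from `[f♯β,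
W]`, cancel and leave only the derivative of `f` along `♯α`. -/
theorem bracketForm_mul_apply (α β γ : Form n M) (f : Fn n M) (h : ∀ x, γ x = f x • β x) (x : M) :
    P.bracketForm α γ x = f x • P.bracketForm α β x + dFun f x (P.sharpForm α x) • β x := by
  refine cot_ext fun v => ?_
  obtain ⟨W, rfl⟩ := exists_vec x v
  have h1 : ∀ X, pair γ X = f * pair β X := fun X => by
    ext y; simp [h]
  have hs : ∀ y, P.sharpForm γ y = f y • P.sharpForm β y := fun y => by
    rw [sharpForm_apply, h, map_smul]; rfl
  have h2 : ∀ g, der (P.sharpForm γ) g = f * der (P.sharpForm β) g := fun g => by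
    ext y; simp [der_apply, hs]
  have h3 : ∀ ξ : Form n M, pair ξ (P.sharpForm γ) = f * pair ξ (P.sharpForm β) := fun g => by
    ext y; simp [hs]
  have h4 : pair α (lie (P.sharpForm γ) W) = f * pair α (lie (P.sharpForm β) W) -
      der W f * pair α (P.sharpForm β) := by
    ext y
    rw [lie_skew, pair_neg, lie_skew _ W]
    have := lie_mul_apply W (P.sharpForm β) (P.sharpForm γ) f hs y
    simp [this]
    ring
  have key : pair (P.bracketForm α γ) W =
      f * pair (P.bracketForm α β) W + der (P.sharpForm α) f * pair β W := by
    rw [pair_bracketForm, pair_bracketForm]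
    simp only [koszul, h1, h2, h3, h4, der_mul]
    ring
  exact congrArg (fun g : Fn n M => g x) key

theorem add_bracketForm (α β γ : Form n M) :
    P.bracketForm (α + β) γ = P.bracketForm α γ + P.bracketForm β γ := by
  refine form_ext fun W => ?_
  simp only [add_pair, pair_bracketForm, koszul, sharpForm_add, pair_add, der_add, add_der, add_lie]
  ring

theorem smul_bracketForm (c : ℝ) (α β : Form n M) :
    P.bracketForm (c • α) β = c • P.bracketForm α β := by
  refine form_ext fun W => ?_
  simp only [smul_pair, pair_bracketForm, koszul, sharpForm_smul, pair_smul, der_smul, smul_der,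
    smul_lie, smul_add, smul_sub]

variable {P}

/-- The Lie algebroid structure that a Poisson structure induces on a subbundle of the cotangent
bundle whose sections are closed under the bracket of 1-forms. -/
def SchoutenZero.lieAlgebroid (hP : P.SchoutenZero) (A : ∀ x : M, Submodule ℝ (Cot n x))
    (hA : IsSmoothSubbundle n (CotMod n) (Cot n (M := M)) A)
    (hbr : ∀ s t : Sections n (CotMod n) (Cot n (M := M)) A,
      P.bracketForm s.1 t.1 ∈ Sections n (CotMod n) (Cot n (M := M)) A) :
    LieAlgebroid n (CotMod n) (Cot n (M := M)) A where
  isSubbundle := hA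
  anchor x := (P.sharp x).comp (A x).subtype
  anchor_smooth U s hU hs := P.smooth U (fun x => (s x : Cot n x)) hU hs
  bracket := LinearMap.mk₂ ℝ (fun s t => ⟨P.bracketForm s.1 t.1, hbr s t⟩)
    (fun _ _ _ => Subtype.ext (P.add_bracketForm _ _ _))
    (fun _ _ _ => Subtype.ext (P.smul_bracketForm _ _ _))
    (fun _ _ _ => Subtype.ext (P.bracketForm_add _ _ _))
    (fun _ _ _ => Subtype.ext (P.bracketForm_smul _ _ _))
  bracket_skew _ _ := Subtype.ext (P.bracketForm_skew _ _)
  jacobi _ _ _ := Subtype.ext (hP.jacobi _ _ _)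
  leibniz s t f x := P.bracketForm_mul_apply s.1 t.1 _ f (fun _ => rfl) x
  anchor_bracket s t x :=
    congrArg (fun X : Vec n M => X x) (hP.sharpForm_bracketForm s.1 t.1)

end BivectorField

/-! ### Smoothness of inverse matrices. -/

section Determinants

variable {n : ℕ} {M : Type*} [TopologicalSpace M] [ChartedSpace (ModelSp n) M]

theorem funSmoothAt_det {ι : Type*} [Fintype ι] [DecidableEq ι] {A : M → Matrix ι ι ℝ} {x : M}
    (hA : ∀ i j, FunSmoothAt n (fun y => A y i j) x) : FunSmoothAt n (fun y => (A y).det) x := by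
  simp only [Matrix.det_apply']
  exact contMDiffAt_finsetSum fun σ _ => contMDiffAt_const.mul
    (contMDiffAt_finsetProd fun i _ => hA _ _)

/-- Cramer's rule: the entries of the adjugate are determinants of `A` with one row replaced by a
constant one. -/
theorem funSmoothAt_inv {ι : Type*} [Fintype ι] [DecidableEq ι] {A : M → Matrix ι ι ℝ} {x : M}
    (hA : ∀ i j, FunSmoothAt n (fun y => A y i j) x) (hx : (A x).det ≠ 0) (i j : ι) :
    FunSmoothAt n (fun y => (A y)⁻¹ i j) x := by
  simp only [Matrix.inv_def, Matrix.smul_apply, Ring.inverse_eq_inv', smul_eq_mul,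
    Matrix.adjugate_apply]
  refine ((funSmoothAt_det hA).inv₀ hx).mul (funSmoothAt_det fun k l => ?_)
  by_cases hk : k = j
  · subst hk
    simpa using contMDiffAt_const
  · simpa [hk] using hA k l

end Determinants

/-! ### Transverse coordinates and smoothness of `p_E`. -/

section Adapted

variable {q p : ℕ} {M : Type*} [TopologicalSpace M] [ChartedSpace (ModelSp (q + p)) M]
  [IsManifold 𝓘(ℝ, ModelSp (q + p)) ∞ M]

/-- `c` is a system of transverse coordinates for `𝓕` on the open set `U`. -/
structure Foliation.IsTransverse (𝓕 : Foliation q p M) (U : Set M) (c : Fin q → M → ℝ) : Prop where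
  isOpen : IsOpen U
  smooth : ∀ a, ∀ y ∈ U, FunSmoothAt (q + p) (c a) y
  mem_tangent_iff : ∀ y ∈ U, ∀ v : Tan (q + p) y, v ∈ 𝓕.tangent y ↔ ∀ a, dFun (c a) y v = 0
  linearIndependent : ∀ y ∈ U, LinearIndependent ℝ fun a => (dFun (c a) y : Cot (q + p) y)

theorem Foliation.exists_isTransverse (𝓕 : Foliation q p M) (x : M) :
    ∃ U c, x ∈ U ∧ 𝓕.IsTransverse U c := by
  obtain ⟨e, he, hx, h⟩ := 𝓕.exists_adapted x
  have hs : ∀ y ∈ e.source, ContMDiffAt 𝓘(ℝ, ModelSp (q + p)) 𝓘(ℝ, ModelSp (q + p)) ∞ e y :=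
    fun y hy => (contMDiffOn_of_mem_maximalAtlas he).contMDiffAt (e.open_source.mem_nhds hy)
  have hd : e.MDifferentiable 𝓘(ℝ, ModelSp (q + p)) 𝓘(ℝ, ModelSp (q + p)) :=
    ⟨(contMDiffOn_of_mem_maximalAtlas he).mdifferentiableOn (by simp),
      (contMDiffOn_symm_of_mem_maximalAtlas he).mdifferentiableOn (by simp)⟩
  have hproj : ∀ (a : Fin q) (y : M), y ∈ e.source → ∀ v : Tan (q + p) y,
      dFun (fun z => (e z : ModelSp (q + p)) (Fin.castAdd p a)) y v =
        (EuclideanSpace.proj (Fin.castAdd p a) : CotMod (q + p))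
          (mfderiv 𝓘(ℝ, ModelSp (q + p)) 𝓘(ℝ, ModelSp (q + p)) e y v) := by
    intro a y hy v
    let T : CotMod (q + p) := EuclideanSpace.proj (Fin.castAdd p a)
    have h1 := mfderiv_comp (I' := 𝓘(ℝ, ModelSp (q + p))) (I'' := 𝓘(ℝ, ℝ)) y (g := T)
      T.differentiableAt.mdifferentiableAt
        ((hs y hy).mdifferentiableAt (by simp))
    rw [mfderiv_eq_fderiv, T.fderiv] at h1
    exact congrArg (fun ξ : Cot (q + p) y => ξ v) h1
  refine ⟨e.source, fun a z => (e z : ModelSp (q + p)) (Fin.castAdd p a), hx, e.open_source,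
    fun a y hy => ?_, h, fun y hy => ?_⟩
  · exact ContMDiffAt.comp y (EuclideanSpace.proj (Fin.castAdd p a) :
      CotMod (q + p)).contMDiff.contMDiffAt (hs y hy)
  · rw [Fintype.linearIndependent_iff]
    intro k hk a
    -- The differential of a chart is onto, so some `v` is dual to the `a`-th coordinate; evaluating
    -- the relation on it isolates `k a`.
    obtain ⟨v, hv⟩ := hd.mfderiv_surjective hy
      (EuclideanSpace.single (Fin.castAdd p a) (1 : ℝ) : ModelSp (q + p))
    have h2 := congrArg (fun ξ : Cot (q + p) y => ξ v) hk
    simp only [_root_.sum_apply, _root_.smul_apply, hproj _ y hy, hv] at h2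
    simpa [Pi.single_apply] using h2

variable {𝓕 : Foliation q p M} {U : Set M} {c : Fin q → M → ℝ}

theorem Foliation.IsTransverse.dFun_mem_conormal (hc : 𝓕.IsTransverse U c) {y : M} (hy : y ∈ U)
    (a : Fin q) : dFun (c a) y ∈ 𝓕.conormal y :=
  fun v hv => (hc.mem_tangent_iff y hy v).1 hv a

/-- A covector vanishing on the common kernel of finitely many covectors is a combination of them.
-/
theorem Foliation.IsTransverse.span_eq (hc : 𝓕.IsTransverse U c) {y : M} (hy : y ∈ U) :
    Submodule.span ℝ (range fun a => (dFun (c a) y : Cot (q + p) y)) = 𝓕.conormal y := by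
  refine le_antisymm (Submodule.span_le.2 ?_) fun ξ hξ => ?_
  · rintro _ ⟨a, rfl⟩
    exact hc.dFun_mem_conormal hy a
  · have h := mem_span_of_iInf_ker_le_ker (𝕜 := ℝ)
      (L := fun a => (dFun (c a) y : Cot (q + p) y).toLinearMap)
      (K := ξ.toLinearMap) fun v hv => hξ v ((hc.mem_tangent_iff y hy v).2 fun a => by
        simpa using (Submodule.mem_iInf _).1 hv a)
    obtain ⟨k, hk⟩ := (Submodule.mem_span_range_iff_exists_fun ℝ).1 h
    refine (Submodule.mem_span_range_iff_exists_fun ℝ).2 ⟨k, cot_ext fun v => ?_⟩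
    simpa using congrArg (fun L => L v) hk

theorem Foliation.isSmoothSubbundle_conormal (𝓕 : Foliation q p M) :
    IsSmoothSubbundle (q + p) (CotMod (q + p)) (Cot (q + p) (M := M)) 𝓕.conormal := by
  intro x
  obtain ⟨U, c, hx, hc⟩ := 𝓕.exists_isTransverse x
  exact ⟨U, hc.isOpen, hx, q, fun a => dFun (c a),
    fun a y hy => (dFun_smoothAt (hc.smooth a y hy)).contMDiffWithinAt,
    fun y hy => ⟨hc.linearIndependent y hy, hc.span_eq hy⟩⟩

namespace ImageExtension

variable {h : ConormalMorphism 𝓕} (E : ImageExtension h)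

theorem proj_mem (x : M) (v : Tan (q + p) x) : E.proj x v ∈ E.fiber x :=
  Submodule.projection_apply_mem (E.isCompl x) v

theorem proj_of_mem {x : M} {v : Tan (q + p) x} (hv : v ∈ E.fiber x) : E.proj x v = v :=
  Submodule.projection_apply_of_mem_left (E.isCompl x) hv

theorem proj_of_mem_tangent {x : M} {v : Tan (q + p) x} (hv : v ∈ 𝓕.tangent x) : E.proj x v = 0 :=
  Submodule.projection_apply_of_mem_right (E.isCompl x) hv

theorem sub_proj_mem (x : M) (v : Tan (q + p) x) : v - E.proj x v ∈ 𝓕.tangent x :=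
  Submodule.sub_projection_mem (E.isCompl x) v

theorem apply_proj {x : M} {ξ : Cot (q + p) x} (hξ : ξ ∈ 𝓕.conormal x) (v : Tan (q + p) x) :
    ξ (E.proj x v) = ξ v := by
  have := hξ _ (E.sub_proj_mem x v)
  rw [map_sub] at this
  linarith

/-- Local smooth expression of `p_E`. -/
theorem exists_proj_eq (x : M) : ∃ (U : Set M) (r : ℕ) (s : Fin r → ∀ y : M, Tan (q + p) y)
    (θ : Fin r → ∀ y : M, Cot (q + p) y), IsOpen U ∧ x ∈ U ∧
    (∀ i, ∀ y ∈ U, VecSmoothAt (s i) y) ∧ (∀ i, ∀ y ∈ U, CovSmoothAt (θ i) y) ∧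
    ∀ y ∈ U, ∀ v, E.proj y v = ∑ i, θ i y v • s i y := by
  obtain ⟨U, c, hxU, hc⟩ := 𝓕.exists_isTransverse x
  obtain ⟨V, hV, hxV, r, s, hs, hs'⟩ := E.isSubbundle x
  have hsm : ∀ i, ∀ y ∈ U ∩ V, VecSmoothAt (s i) y := fun i y hy =>
    (hs i).contMDiffAt (hV.mem_nhds hy.2)
  let A : M → Matrix (Fin q) (Fin r) ℝ := fun y => Matrix.of fun a i => dFun (c a) y (s i y)
  have hA : ∀ a i, ∀ y ∈ U ∩ V, FunSmoothAt (q + p) (fun y => A y a i) y := fun a i y hy =>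
    (dFun_smoothAt (hc.smooth a y hy.1)).pair (hsm i y hy)
  -- `A` is injective because `E ∩ TF = 0`. The Gram matrix `AᵀA` is then invertible and `(AᵀA)⁻¹Aᵀ`
  -- is a smooth left inverse of `A`, with no need to know that `r = q`; it recovers the
  -- coefficients of `p_E v` from the numbers `dc_a(v)`.
  let G : M → Matrix (Fin r) (Fin r) ℝ := fun y => (A y).transpose * A y
  have hG : ∀ i j, ∀ y ∈ U ∩ V, FunSmoothAt (q + p) (fun y => G y i j) y := fun i j y hy => by
    simp only [G, Matrix.mul_apply, Matrix.transpose_apply]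
    exact contMDiffAt_finsetSum fun a _ => (hA a i y hy).mul (hA a j y hy)
  have hAinj : ∀ y ∈ U ∩ V, ∀ k : Fin r → ℝ, (A y).mulVec k = 0 → k = 0 := by
    intro y hy k hk
    have h1 : ∑ i, k i • s i y ∈ E.fiber y := by
      rw [← (hs' y hy.2).2]
      exact (Submodule.mem_span_range_iff_exists_fun ℝ).2 ⟨k, rfl⟩
    have h2 : ∑ i, k i • s i y ∈ 𝓕.tangent y := (hc.mem_tangent_iff y hy.1 _).2 fun a => by
      have := congrFun hk a
      simpa [Matrix.mulVec, dotProduct, A, mul_comm] using this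
    have h3 : ∑ i, k i • s i y = 0 := by
      have := (E.isCompl y).disjoint.le_bot ⟨h1, h2⟩
      simpa using this
    exact funext (Fintype.linearIndependent_iff.1 (hs' y hy.2).1 k h3)
  have hdet : ∀ y ∈ U ∩ V, (G y).det ≠ 0 := by
    intro y hy h0
    obtain ⟨k, hk, hk'⟩ := Matrix.exists_mulVec_eq_zero_iff.2 h0
    refine hk (hAinj y hy k ?_)
    rw [← Matrix.conjTranspose_mul_self_mulVec_eq_zero, Matrix.conjTranspose_eq_transpose_of_trivial]
    exact hk'
  let N : M → Matrix (Fin r) (Fin q) ℝ := fun y => (G y)⁻¹ * (A y).transpose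
  have hN : ∀ i a, ∀ y ∈ U ∩ V, FunSmoothAt (q + p) (fun y => N y i a) y := fun i a y hy => by
    simp only [N, Matrix.mul_apply, Matrix.transpose_apply]
    exact contMDiffAt_finsetSum fun j _ =>
      (funSmoothAt_inv (fun i j => hG i j y hy) (hdet y hy) i j).mul (hA a j y hy)
  refine ⟨U ∩ V, r, s, fun i y => ∑ a, N y i a • dFun (c a) y, hc.isOpen.inter hV, ⟨hxU, hxV⟩,
    hsm, fun i y hy => ?_, fun y hy v => ?_⟩
  · exact ContMDiffAt.sum_section fun a _ => (hN i a y hy).smul_section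
      (dFun_smoothAt (hc.smooth a y hy.1))
  · have h1 : E.proj y v ∈ Submodule.span ℝ (range fun i => s i y) := by
      rw [(hs' y hy.2).2]; exact E.proj_mem y v
    obtain ⟨k, hk⟩ := (Submodule.mem_span_range_iff_exists_fun ℝ).1 h1
    have h2 : (fun a => dFun (c a) y v) = (A y).mulVec k := by
      funext a
      rw [← E.apply_proj (hc.dFun_mem_conormal hy.1 a), ← hk]
      simp [Matrix.mulVec, dotProduct, A, mul_comm]
    have h3 : (N y).mulVec (fun a => dFun (c a) y v) = k := by
      rw [h2, Matrix.mulVec_mulVec, Matrix.mul_assoc, Matrix.nonsing_inv_mul _ (hdet y hy).isUnit,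
        Matrix.one_mulVec]
    rw [← hk]
    refine Finset.sum_congr rfl fun i _ => ?_
    congr 1
    rw [← h3]
    simp [Matrix.mulVec, dotProduct]

theorem proj_vecSmoothAt {X : ∀ y : M, Tan (q + p) y} {x : M} (hX : VecSmoothAt X x) :
    VecSmoothAt (fun y => E.proj y (X y)) x := by
  obtain ⟨U, r, s, θ, hU, hx, hs, hθ, h⟩ := E.exists_proj_eq x
  have : VecSmoothAt (fun y => ∑ i, θ i y (X y) • s i y) x :=
    ContMDiffAt.sum_section fun i _ => ((hθ i x hx).pair hX).smul_section (hs i x hx)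
  refine this.congr_of_eventuallyEq ?_
  filter_upwards [hU.mem_nhds hx] with y hy
  rw [h y hy]

theorem comp_proj_covSmoothAt {α : ∀ y : M, Cot (q + p) y} {x : M} (hα : CovSmoothAt α x) :
    CovSmoothAt (fun y => (α y).comp (E.proj y)) x := by
  obtain ⟨U, r, s, θ, hU, hx, hs, hθ, h⟩ := E.exists_proj_eq x
  have : CovSmoothAt (fun y => ∑ i, α y (s i y) • θ i y) x :=
    ContMDiffAt.sum_section fun i _ => (hα.pair (hs i x hx)).smul_section (hθ i x hx)
  refine this.congr_of_eventuallyEq ?_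
  filter_upwards [hU.mem_nhds hx] with y hy
  congr 1
  refine cot_ext fun v => ?_
  simp [h y hy, mul_comm]

end ImageExtension
end Adapted

/-! ### The extension of `h` to all covectors. -/

namespace ImageExtension

variable {q p : ℕ} {M : Type*} [TopologicalSpace M] [ChartedSpace (ModelSp (q + p)) M]
  [IsManifold 𝓘(ℝ, ModelSp (q + p)) ∞ M] {𝓕 : Foliation q p M} {h : ConormalMorphism 𝓕}
  (E : ImageExtension h)

theorem comp_proj_mem (x : M) (ξ : Cot (q + p) x) : ξ.comp (E.proj x) ∈ 𝓕.conormal x :=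
  fun v hv => by rw [ContinuousLinearMap.comp_apply, E.proj_of_mem_tangent hv, map_zero]

theorem comp_proj_of_mem {x : M} {ξ : Cot (q + p) x} (hξ : ξ ∈ 𝓕.conormal x) :
    ξ.comp (E.proj x) = ξ := cot_ext fun v => E.apply_proj hξ v

/-- The `(1,0)`-component of a covector. -/
def toConormal (x : M) : Cot (q + p) x →ₗ[ℝ] 𝓕.conormal x where
  toFun ξ := ⟨ξ.comp (E.proj x), E.comp_proj_mem x ξ⟩
  map_add' _ _ := rfl
  map_smul' _ _ := rfl

/-- The extension of `h` to all covectors by `0` on the annihilator of `E`. -/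
def sharp (x : M) : Cot (q + p) x →ₗ[ℝ] Tan (q + p) x := (h.toFun x).comp (E.toConormal x)

theorem sharp_of_mem {x : M} {ξ : Cot (q + p) x} (hξ : ξ ∈ 𝓕.conormal x) :
    E.sharp x ξ = h.toFun x ⟨ξ, hξ⟩ :=
  congrArg (h.toFun x) (Subtype.ext (E.comp_proj_of_mem hξ))

theorem sharp_mem_range (x : M) (ξ : Cot (q + p) x) : E.sharp x ξ ∈ LinearMap.range (h.toFun x) :=
  ⟨_, rfl⟩

theorem sharp_mem (x : M) (ξ : Cot (q + p) x) : E.sharp x ξ ∈ E.fiber x := E.image_mem x _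

theorem sharp_comp_proj (x : M) (ξ : Cot (q + p) x) : E.sharp x (ξ.comp (E.proj x)) = E.sharp x ξ :=
  E.sharp_of_mem (E.comp_proj_mem x ξ)

theorem comp_proj_sharp {x : M} (ξ η : Cot (q + p) x) :
    (ξ.comp (E.proj x)) (E.sharp x η) = ξ (E.sharp x η) := by
  rw [ContinuousLinearMap.comp_apply, E.proj_of_mem (E.sharp_mem x η)]

/-- Extend `v` to any field `V` and take `V - p_E V`. -/
theorem exists_tangent_vec [T2Space M] (E : ImageExtension h) {x : M} {v : Tan (q + p) x} (hv : v ∈ 𝓕.tangent x) :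
    ∃ Y : Vec (q + p) M, (∀ y, Y y ∈ 𝓕.tangent y) ∧ Y x = v := by
  obtain ⟨V, rfl⟩ := exists_vec x v
  let W : Vec (q + p) M := ⟨fun y => E.proj y (V y), fun y => E.proj_vecSmoothAt (V.contMDiff y)⟩
  refine ⟨V - W, fun y => E.sub_proj_mem y (V y), ?_⟩
  have : W x = 0 := E.proj_of_mem_tangent hv
  rw [ContMDiffSection.coe_sub, Pi.sub_apply, this, sub_zero]

end ImageExtension

/-! ### Foliated forms and the hamiltonian conditions. -/

section Foliated

variable {q p : ℕ} {M : Type*} [TopologicalSpace M] [ChartedSpace (ModelSp (q + p)) M]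
  [IsManifold 𝓘(ℝ, ModelSp (q + p)) ∞ M]

/-- A global section of the conormal bundle which is foliated near `x`. -/
def Foliation.FoliatedNear (𝓕 : Foliation q p M) (x : M) (α : Form (q + p) M) : Prop :=
  ∃ (hα : ∀ y, α y ∈ 𝓕.conormal y) (U : Set M), IsOpen U ∧ x ∈ U ∧
    𝓕.IsFoliatedForm U fun y => ⟨α y, hα y⟩

theorem Foliation.IsFoliatedForm.mono {𝓕 : Foliation q p M} {U V : Set M}
    {α : ∀ x, 𝓕.conormal x} (h : 𝓕.IsFoliatedForm U α) (hV : V ⊆ U) : 𝓕.IsFoliatedForm V α :=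
  ⟨h.1.mono hV, fun x hx => h.2 x (hV hx)⟩

variable {𝓕 : Foliation q p M} {h : ConormalMorphism 𝓕} (E : ImageExtension h)

/-- The form `d'f`. -/
def ImageExtension.dPrime (f : Fn (q + p) M) : Form (q + p) M :=
  ⟨fun y => (E.dPrimeFun f y).1, fun y => E.comp_proj_covSmoothAt (dFun_smoothAt (f.contMDiff y))⟩

/-- Reduces linear statements on the fibre of `ν*F` at `x` to values of foliated forms, to which the
hamiltonian conditions apply: these values contain the differentials of transverse coordinates, a
spanning set. -/
theorem ImageExtension.conormal_induction [T2Space M] (E : ImageExtension h) {x : M} {P : Cot (q + p) x → Prop}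
    (hadd : ∀ ξ η, P ξ → P η → P (ξ + η)) (hsmul : ∀ (c : ℝ) ξ, P ξ → P (c • ξ)) (hzero : P 0)
    (hfol : ∀ α : Form (q + p) M, 𝓕.FoliatedNear x α → P (α x))
    {ξ : Cot (q + p) x} (hξ : ξ ∈ 𝓕.conormal x) : P ξ := by
  obtain ⟨U, c, hx, hc⟩ := 𝓕.exists_isTransverse x
  rw [← hc.span_eq hx] at hξ
  refine Submodule.span_induction (p := fun ξ _ => P ξ) ?_ hzero (fun ξ η _ _ => hadd ξ η)
    (fun c ξ _ => hsmul c ξ) hξ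
  rintro _ ⟨a, rfl⟩
  obtain ⟨f, hf⟩ := exists_fun_germ hc.isOpen hx (hc.smooth a)
  obtain ⟨V, hV, hVo, hxV⟩ := mem_nhds_iff.1 (hf.and (hc.isOpen.mem_nhds hx))
  have hd : ∀ y ∈ V, dFun f y = (dFun (c a) y : Cot (q + p) y) := fun y hy =>
    dFun_congr (Filter.eventually_of_mem (hVo.mem_nhds hy) fun z hz => (hV hz).1)
  have hd' : ∀ y ∈ V, E.dPrime f y = (dFun f y : Cot (q + p) y) := fun y hy =>
    E.comp_proj_of_mem (by rw [hd y hy]; exact hc.dFun_mem_conormal (hV hy).2 a)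
  -- A global section of `ν*F` is required, hence `d'f` and not `df`. Near `x` both agree with the
  -- differential of a transverse coordinate, so `d'f` is closed there.
  have hfol' : 𝓕.FoliatedNear x (E.dPrime f) := by
    refine ⟨fun y => (E.dPrimeFun f y).2, V, hVo, hxV,
      (E.dPrime f).contMDiff.contMDiffOn, fun y hy v _ => ?_⟩
    have h1 : dForm (E.dPrime f) y = dForm (dFun f) y :=
      dForm_congr (Filter.eventually_of_mem (hVo.mem_nhds hy) hd')
    exact (congrFun h1 v).trans (dForm_dFun (f.contMDiff y) v)
  have := hfol _ hfol'
  rwa [hd' x hxV, hd x hxV] at this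

/-- Both sides are bilinear, so two inductions reduce to forms that are foliated on a common
neighbourhood of `x`. -/
theorem ImageExtension.sharp_skew_of_mem [T2Space M] (hh : h.IsHamiltonian) {x : M}
    {ξ η : Cot (q + p) x} (hξ : ξ ∈ 𝓕.conormal x) (hη : η ∈ 𝓕.conormal x) :
    ξ (E.sharp x η) = - η (E.sharp x ξ) := by
  refine E.conormal_induction (P := fun ξ => ξ (E.sharp x η) = - η (E.sharp x ξ))
    (fun ξ ξ' h1 h2 => ?_) (fun c ξ h1 => ?_) (by simp) (fun α hα => ?_) hξ
  · simp only [map_add, _root_.add_apply, h1, h2]; ring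
  · simp only [map_smul, _root_.smul_apply, h1, smul_eq_mul]; ring
  refine E.conormal_induction (P := fun η => α x (E.sharp x η) = - η (E.sharp x (α x)))
    (fun ξ ξ' h1 h2 => ?_) (fun c ξ h1 => ?_) (by simp) (fun β hβ => ?_) hη
  · simp only [map_add, _root_.add_apply, h1, h2]; ring
  · simp only [map_smul, _root_.smul_apply, h1, smul_eq_mul]; ring
  obtain ⟨hα, U, hU, hxU, hαU⟩ := hα
  obtain ⟨hβ, V, hV, hxV, hβV⟩ := hβ
  rw [E.sharp_of_mem (hα x), E.sharp_of_mem (hβ x)]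
  exact hh.skew (U ∩ V) _ _ (hU.inter hV) (hαU.mono inter_subset_left)
    (hβV.mono inter_subset_right) x ⟨hxU, hxV⟩

/-- The bivector field `P` with `P(df, dg) = {f, g}'`. -/
def ImageExtension.poisson [T2Space M] (hh : h.IsHamiltonian) : BivectorField (q + p) M where
  sharp := E.sharp
  skew x ξ η := by
    -- Every covector may be replaced by its conormal component, both inside `♯` and when paired
    -- with a value of `♯`.
    rw [← E.comp_proj_sharp, ← E.comp_proj_sharp ξ, ← E.sharp_comp_proj x ξ,
      ← E.sharp_comp_proj x η]
    exact E.sharp_skew_of_mem hh (E.comp_proj_mem x η) (E.comp_proj_mem x ξ)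
  smooth U α hU hα := h.smooth U (fun x => E.toConormal x (α x)) hU fun x hx =>
    (E.comp_proj_covSmoothAt (hα.contMDiffAt (hU.mem_nhds hx))).contMDiffWithinAt

theorem pair_eq_zero {α : Form (q + p) M} (hα : ∀ y, α y ∈ 𝓕.conormal y)
    {Y : Vec (q + p) M} (hY : ∀ y, Y y ∈ 𝓕.tangent y) : pair α Y = 0 := by
  ext x
  exact hα x _ (hY x)

variable [T2Space M] (hh : h.IsHamiltonian)

theorem Foliation.FoliatedNear.lie_mem {x : M} {α : Form (q + p) M} (hα : 𝓕.FoliatedNear x α)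
    {Y : Vec (q + p) M} (hY : ∀ y, Y y ∈ 𝓕.tangent y) :
    lie ((E.poisson hh).sharpForm α) Y x ∈ 𝓕.tangent x := by
  obtain ⟨hα, U, hU, hxU, hαU⟩ := hα
  have h1 := (hh.foliated U _ hU hαU).2 U Y hU Subset.rfl Y.contMDiff.contMDiffOn
    (fun y _ => hY y) x hxU
  have h2 : (h.onSec fun y => ⟨α y, hα y⟩) = (E.poisson hh).sharpForm α :=
    funext fun y => (E.sharp_of_mem (hα y)).symm
  rwa [h2] at h1

/-- For `Y` tangent, `(L_{♯α}β)(Y) = -β([♯α,Y])`, and `[♯α,Y]` is tangent at `x` because `♯α` is a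
foliated field near `x`. -/
theorem Foliation.FoliatedNear.lieDeriv_mem {x : M} {α β : Form (q + p) M}
    (hα : 𝓕.FoliatedNear x α) (hβ : ∀ y, β y ∈ 𝓕.conormal y) :
    lieDeriv ((E.poisson hh).sharpForm α) β x ∈ 𝓕.conormal x := by
  intro v hv
  obtain ⟨Y, hY, rfl⟩ := E.exists_tangent_vec hv
  rw [lieDeriv_apply, pair_eq_zero hβ hY, der_zero, zero_sub]
  have := hβ x _ (hα.lie_mem E hh hY)
  exact neg_eq_zero.2 this

/-- By skewness `⟨H L_{Hα}β, γ⟩ = -(L_{Hα}β)(Hγ)`. Each term of the Gelfand-Dorfman bracket counts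
this twice, so the cyclic sum is `-2` times the Schouten expression. -/
theorem schouten_foliatedNear {x : M} {α β γ : Form (q + p) M}
    (hα : 𝓕.FoliatedNear x α) (hβ : 𝓕.FoliatedNear x β) (hγ : 𝓕.FoliatedNear x γ) :
    schouten α ((E.poisson hh).sharpForm α) β ((E.poisson hh).sharpForm β) γ
      ((E.poisson hh).sharpForm γ) x = 0 := by
  have key : ∀ {α β γ : Form (q + p) M}, 𝓕.FoliatedNear x α → ∀ (hα : ∀ y, α y ∈ 𝓕.conormal y)
      (hβ : ∀ y, β y ∈ 𝓕.conormal y) (hγ : ∀ y, γ y ∈ 𝓕.conormal y),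
      ConormalMorphism.gdTerm h h (fun y => ⟨α y, hα y⟩) (fun y => ⟨β y, hβ y⟩)
        (fun y => ⟨γ y, hγ y⟩) x = - 2 * (der ((E.poisson hh).sharpForm α)
          (pair β ((E.poisson hh).sharpForm γ)) + pair β (lie ((E.poisson hh).sharpForm γ)
            ((E.poisson hh).sharpForm α))) x := by
    intro α β γ hαf hα hβ hγ
    have h2 : (h.onSec fun y => ⟨α y, hα y⟩) = (E.poisson hh).sharpForm α :=
      funext fun y => (E.sharp_of_mem (hα y)).symm
    have h3 := hαf.lieDeriv_mem E hh hβ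
    -- Together with `h3`, which excludes the default value `0` of `app`, this makes the term
    -- explicit.
    have h4 := lieDeriv_apply ((E.poisson hh).sharpForm α) β ((E.poisson hh).sharpForm γ) x
    unfold ConormalMorphism.gdTerm
    simp only [h2]
    unfold ConormalMorphism.app
    rw [dif_pos h3, ← E.sharp_of_mem h3, E.sharp_skew_of_mem hh (hγ x) h3]
    change -(lieDeriv ((E.poisson hh).sharpForm α) β x) ((E.poisson hh).sharpForm γ x) +
      -(lieDeriv ((E.poisson hh).sharpForm α) β x) ((E.poisson hh).sharpForm γ x) = _
    rw [h4, lie_skew ((E.poisson hh).sharpForm γ), pair_neg]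
    simp only [ContMDiffMap.coe_sub, ContMDiffMap.coe_add, ContMDiffMap.coe_neg, Pi.add_apply,
      Pi.sub_apply, Pi.neg_apply]
    ring
  obtain ⟨hα', U, hU, hxU, hαU⟩ := id hα
  obtain ⟨hβ', V, hV, hxV, hβV⟩ := id hβ
  obtain ⟨hγ', W, hW, hxW, hγW⟩ := id hγ
  have hp := hh.poisson (U ∩ V ∩ W) _ _ _ ((hU.inter hV).inter hW)
    (hαU.mono (inter_subset_left.trans inter_subset_left))
    (hβV.mono (inter_subset_left.trans inter_subset_right)) (hγW.mono inter_subset_right)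
    x ⟨⟨hxU, hxV⟩, hxW⟩
  rw [ConormalMorphism.gdBracket, key hα hα' hβ' hγ', key hβ hβ' hγ' hα', key hγ hγ' hα' hβ'] at hp
  simp only [schouten, ContMDiffMap.coe_add, Pi.add_apply] at hp ⊢
  linear_combination (-1 / 2) * hp

end Foliated

/-! ### Cyclicity and tensoriality. -/

theorem schouten_rotate {n : ℕ} {M : Type*} [TopologicalSpace M] [ChartedSpace (ModelSp n) M]
    [IsManifold 𝓘(ℝ, ModelSp n) ∞ M] (α β γ : Form n M) (A B C : Vec n M) :
    schouten α A β B γ C = schouten β B γ C α A := by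
  unfold schouten
  ring

/-- Shows that the Schouten expression depends on `γ` only pointwise, as the pairing with a fixed
field. -/
theorem BivectorField.schouten_eq_pair {n : ℕ} {M : Type*} [TopologicalSpace M] [T2Space M]
    [ChartedSpace (ModelSp n) M] [IsManifold 𝓘(ℝ, ModelSp n) ∞ M] (P : BivectorField n M)
    (α β γ : Form n M) :
    schouten α (P.sharpForm α) β (P.sharpForm β) γ (P.sharpForm γ) =
      pair γ (lie (P.sharpForm α) (P.sharpForm β) - P.sharpForm (P.bracketForm α β)) := by
  rw [pair_sub, P.pair_sharpForm (P.bracketForm α β), pair_bracketForm]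
  unfold koszul schouten
  rw [P.pair_sharpForm α γ, lie_skew (P.sharpForm γ), pair_neg, der_neg]
  ring

theorem BivectorField.ext_sharp {n : ℕ} {M : Type*} [TopologicalSpace M]
    [ChartedSpace (ModelSp n) M] [IsManifold 𝓘(ℝ, ModelSp n) ∞ M] {P Q : BivectorField n M}
    (h : ∀ x ξ, P.sharp x ξ = Q.sharp x ξ) : P = Q := by
  obtain ⟨s, _, _⟩ := P
  obtain ⟨t, _, _⟩ := Q
  obtain rfl : s = t := funext fun x => LinearMap.ext (h x)
  rfl

section

variable {n : ℕ} {M : Type*} [TopologicalSpace M] [ChartedSpace (ModelSp n) M]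

theorem dForm_apply_apply (α : ∀ x : M, Cot n x) (x : M) (v w : Tan n x) :
    dForm α x v w =
      fderiv ℝ (chartForm α x) (extChartAt 𝓘(ℝ, ModelSp n) x x) (chartDeriv x v) (chartDeriv x w) -
      fderiv ℝ (chartForm α x) (extChartAt 𝓘(ℝ, ModelSp n) x x) (chartDeriv x w)
        (chartDeriv x v) := rfl

theorem dForm_skew (α : ∀ x : M, Cot n x) (x : M) (v w : Tan n x) :
    dForm α x v w = - dForm α x w v := by
  rw [dForm_apply_apply, dForm_apply_apply, neg_sub]

theorem dForm_add (α : ∀ x : M, Cot n x) (x : M) (v w : Tan n x) :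
    dForm α x (v + w) = dForm α x v + dForm α x w := by
  refine cot_ext fun u => ?_
  rw [_root_.add_apply, dForm_skew, map_add, dForm_skew α x v, dForm_skew α x w, neg_add]

theorem dForm_smul (α : ∀ x : M, Cot n x) (x : M) (c : ℝ) (v : Tan n x) :
    dForm α x (c • v) = c • dForm α x v := by
  refine cot_ext fun u => ?_
  rw [_root_.smul_apply, dForm_skew, map_smul, dForm_skew α x v, smul_neg]

end

/-! ### Tameness, closure of `ν*F` under the bracket, and the two algebroids. -/

namespace ImageExtension

variable {q p : ℕ} {M : Type*} [TopologicalSpace M] [T2Space M] [ChartedSpace (ModelSp (q + p)) M]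
  [IsManifold 𝓘(ℝ, ModelSp (q + p)) ∞ M] {𝓕 : Foliation q p M} {h : ConormalMorphism 𝓕}
  {E : ImageExtension h} (hh : h.IsHamiltonian)

/-- The one place where tameness acts: it puts `[♯α,♯β] - ♯{α,β}_P` in `E`, where `γ` and its
conormal component agree. The other two forms stay arbitrary, so the argument can be repeated after
a rotation. -/
theorem IsTame.schouten_apply_eq_zero (hE : E.IsTame) {x : M} {α β : Form (q + p) M}
    (hfol : ∀ γ, 𝓕.FoliatedNear x γ → schouten α ((E.poisson hh).sharpForm α) β
      ((E.poisson hh).sharpForm β) γ ((E.poisson hh).sharpForm γ) x = 0) (γ : Form (q + p) M) :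
    schouten α ((E.poisson hh).sharpForm α) β ((E.poisson hh).sharpForm β) γ
      ((E.poisson hh).sharpForm γ) x = 0 := by
  have hT : ∀ γ : Form (q + p) M, schouten α ((E.poisson hh).sharpForm α) β
      ((E.poisson hh).sharpForm β) γ ((E.poisson hh).sharpForm γ) x =
      γ x (lie ((E.poisson hh).sharpForm α) ((E.poisson hh).sharpForm β) x -
        E.sharp x ((E.poisson hh).bracketForm α β x)) := fun γ => by
    rw [BivectorField.schouten_eq_pair]
    rfl
  rw [hT]
  simp only [hT] at hfol
  set T := lie ((E.poisson hh).sharpForm α) ((E.poisson hh).sharpForm β) x -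
    E.sharp x ((E.poisson hh).bracketForm α β x) with hTdef
  have hTE : T ∈ E.fiber x := by
    refine (E.fiber x).sub_mem ?_ (E.sharp_mem x _)
    exact hE _ _ ((E.poisson hh).sharpForm α).contMDiff.contMDiffOn
      ((E.poisson hh).sharpForm β).contMDiff.contMDiffOn
      (fun y => E.sharp_mem_range y _) (fun y => E.sharp_mem_range y _) x
  rw [← E.proj_of_mem hTE]
  exact E.conormal_induction (P := fun ξ => ξ T = 0)
    (fun ξ η h1 h2 => by simp [h1, h2]) (fun c ξ h1 => by simp [h1]) (by simp) hfol
    (E.comp_proj_mem x (γ x))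

theorem IsTame.schoutenZero (hE : E.IsTame) : (E.poisson hh).SchoutenZero := by
  intro α β γ
  ext x
  refine hE.schouten_apply_eq_zero hh (fun γ hγ => ?_) γ
  -- Two rotations bring the next form to the last slot.
  rw [schouten_rotate, schouten_rotate]
  refine hE.schouten_apply_eq_zero hh (fun β hβ => ?_) β
  rw [schouten_rotate, schouten_rotate]
  refine hE.schouten_apply_eq_zero hh (fun α hα => ?_) α
  rw [schouten_rotate, schouten_rotate]
  exact schouten_foliatedNear E hh hα hβ hγ

omit [T2Space M] in
-- `α(Y)` and `β(Y)` vanish identically, and what remains of the terms in `α` is `-dα(B, Y)`. The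
-- result involves `β` and `B` only at `x`.
theorem koszul_tangent {x : M} {α β : Form (q + p) M}
    (hα : ∀ y, α y ∈ 𝓕.conormal y) (hβ : ∀ y, β y ∈ 𝓕.conormal y)
    {Y : Vec (q + p) M} (hY : ∀ y, Y y ∈ 𝓕.tangent y) (A B : Vec (q + p) M) :
    koszul α A β B Y x = - (β x (lie A Y x) + dForm α x (B x) (Y x)) := by
  rw [dForm_apply (α.contMDiff x) (B.contMDiff x) (Y.contMDiff x)]
  change _ = -(pair β (lie A Y) x + (der B (pair α Y) x - der Y (pair α B) x - pair α (lie B Y) x))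
  simp only [koszul, ContMDiffMap.coe_sub, ContMDiffMap.coe_add, Pi.sub_apply, Pi.add_apply,
    pair_eq_zero hα hY, pair_eq_zero hβ hY, der_zero, ContMDiffMap.coe_zero, Pi.zero_apply]
  ring

/-- If the bracket with all forms that are foliated near `x` is conormal at `x`, so is the bracket
with all sections of the conormal bundle. -/
theorem bracketForm_mem_of_foliatedNear {x : M} {α : Form (q + p) M}
    (hα : ∀ y, α y ∈ 𝓕.conormal y)
    (hfol : ∀ β, 𝓕.FoliatedNear x β → (E.poisson hh).bracketForm α β x ∈ 𝓕.conormal x)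
    {β : Form (q + p) M} (hβ : ∀ y, β y ∈ 𝓕.conormal y) :
    (E.poisson hh).bracketForm α β x ∈ 𝓕.conormal x := by
  intro v hv
  obtain ⟨Y, hY, rfl⟩ := E.exists_tangent_vec hv
  have key : ∀ β : Form (q + p) M, (∀ y, β y ∈ 𝓕.conormal y) →
      (E.poisson hh).bracketForm α β x (Y x) =
      -(β x (lie ((E.poisson hh).sharpForm α) Y x) + dForm α x (E.sharp x (β x)) (Y x)) :=
    fun β hβ => ((E.poisson hh).formBracket_apply α β Y x).trans (koszul_tangent hα hβ hY _ _)
  rw [key β hβ]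
  -- By `key` the value depends linearly on the covector `β x` alone.
  refine E.conormal_induction (P := fun ξ =>
    -(ξ (lie ((E.poisson hh).sharpForm α) Y x) + dForm α x (E.sharp x ξ) (Y x)) = 0)
    (fun ξ η h1 h2 => ?_) (fun c ξ h1 => ?_) ?_ (fun γ hγ => ?_) (hβ x)
  · simp only [map_add, dForm_add, _root_.add_apply]
    linear_combination h1 + h2
  · simp only [map_smul, dForm_smul, _root_.smul_apply, smul_eq_mul]
    linear_combination c * h1
  · have h0 := dForm_smul α x 0 0
    rw [zero_smul, zero_smul] at h0
    simp [h0]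
  · rw [← key γ hγ.choose]
    exact hfol γ hγ _ hv

theorem bracketForm_mem_of_foliatedNear_of_foliatedNear {x : M} {α β : Form (q + p) M}
    (hα : 𝓕.FoliatedNear x α) (hβ : 𝓕.FoliatedNear x β) :
    (E.poisson hh).bracketForm α β x ∈ 𝓕.conormal x := by
  intro v hv
  obtain ⟨Y, hY, rfl⟩ := E.exists_tangent_vec hv
  have h1 := hβ.choose x _ (hα.lie_mem E hh hY)
  obtain ⟨hα', U, hU, hxU, hαU⟩ := hα
  refine ((E.poisson hh).formBracket_apply α β Y x).trans ?_
  have h2 : dForm α x (Y x) = 0 := hαU.2 x hxU _ hv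
  rw [koszul_tangent hα' hβ.choose hY, h1, dForm_skew, h2]
  simp

/-- Reduction to foliated forms in one argument, then in the other by skewness. -/
theorem bracketForm_mem {α β : Form (q + p) M} (hα : ∀ y, α y ∈ 𝓕.conormal y)
    (hβ : ∀ y, β y ∈ 𝓕.conormal y) (x : M) :
    (E.poisson hh).bracketForm α β x ∈ 𝓕.conormal x := by
  refine bracketForm_mem_of_foliatedNear hh hα (fun β hβf => ?_) hβ
  rw [BivectorField.bracketForm_skew]
  refine (𝓕.conormal x).neg_mem (bracketForm_mem_of_foliatedNear hh hβf.choose (fun α hαf => ?_) hα)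
  exact bracketForm_mem_of_foliatedNear_of_foliatedNear hh hβf hαf

omit [T2Space M] in
-- Since `p_E X = X`, composing both Cartan terms of `L_X α` with `p_E` gives those of `L'_X α`.
theorem lieDerivPrime_eq (E : ImageExtension h) {X : ∀ x : M, Tan (q + p) x}
    (hX : ∀ x, X x ∈ E.fiber x) (α : ∀ x, 𝓕.conormal x) (x : M) :
    E.lieDerivPrime X α x = (lieDeriv X (fun y => (α y).1) x).comp (E.proj x) := by
  unfold lieDerivPrime dPrimeForm
  rw [E.proj_of_mem (hX x)]
  exact add_comm (G := Cot (q + p) x) _ _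

/-- The left side is `{α,β}_P ∘ p_E`, and `p_E` changes nothing because `{α,β}_P` is already
conormal. -/
theorem formBracket_eq {α β : Form (q + p) M} (hα : ∀ y, α y ∈ 𝓕.conormal y)
    (hβ : ∀ y, β y ∈ 𝓕.conormal y) (x : M) :
    E.formBracket (fun y => ⟨α y, hα y⟩) (fun y => ⟨β y, hβ y⟩) x =
      (E.poisson hh).bracketForm α β x := by
  refine Eq.trans ?_ (E.comp_proj_of_mem (bracketForm_mem hh hα hβ x))
  have h2 : ∀ {α : Form (q + p) M} (hα : ∀ y, α y ∈ 𝓕.conormal y),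
      (h.onSec fun y => ⟨α y, hα y⟩) = fun y => E.sharp y (α y) := fun hα =>
    funext fun y => (E.sharp_of_mem (hα y)).symm
  unfold formBracket
  rw [h2, h2, E.lieDerivPrime_eq fun y => E.sharp_mem y _,
    E.lieDerivPrime_eq fun y => E.sharp_mem y _]
  rfl

theorem induces_poisson (E : ImageExtension h) : E.Induces (E.poisson hh) := fun _ _ _ => rfl

theorem Induces.eq_poisson {P : BivectorField (q + p) M} (hP : E.Induces P) :
    P = E.poisson hh := by
  refine BivectorField.ext_sharp fun x ξ => tan_ext fun η => ?_
  obtain ⟨f, rfl⟩ := exists_fun_dFun x ξ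
  obtain ⟨g, rfl⟩ := exists_fun_dFun x η
  exact hP f g x

/-- The cotangent Lie algebroid of the Poisson structure of a tame hamiltonian structure. -/
def IsTame.cotangentAlgebroid (hE : E.IsTame) :
    LieAlgebroid (q + p) (CotMod (q + p)) (Cot (q + p) (M := M)) (fun _ => ⊤) :=
  (hE.schoutenZero hh).lieAlgebroid _ (isSmoothSubbundle_top _ _) fun _ _ _ => Submodule.mem_top

/-- The Lie algebroid of a tame hamiltonian structure on the conormal bundle. -/
def IsTame.conormalAlgebroid (hE : E.IsTame) :
    LieAlgebroid (q + p) (CotMod (q + p)) (Cot (q + p) (M := M)) 𝓕.conormal :=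
  (hE.schoutenZero hh).lieAlgebroid _ 𝓕.isSmoothSubbundle_conormal fun s t x =>
    bracketForm_mem hh s.2 t.2 x

theorem IsTame.isSubalgebroid (hE : E.IsTame) :
    (hE.conormalAlgebroid hh).IsSubalgebroid (hE.cotangentAlgebroid hh) := by
  refine ⟨fun _ => le_top, fun _ _ _ _ => rfl, fun s t s' t' hs ht => ?_⟩
  exact congrArg₂ (E.poisson hh).bracketForm hs ht

theorem IsTame.cotangentAlgebroid_bracket (hE : E.IsTame)
    (s t : Sections (q + p) (CotMod (q + p)) (Cot (q + p) (M := M)) (fun _ => ⊤)) :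
    ⇑((hE.cotangentAlgebroid hh).bracket s t).1 = (E.poisson hh).formBracket s.1 t.1 := rfl

theorem IsTame.cotangentAlgebroid_anchor (hE : E.IsTame) (x : M)
    (ξ : (⊤ : Submodule ℝ (Cot (q + p) x))) :
    (hE.cotangentAlgebroid hh).anchor x ξ = (E.poisson hh).sharp x ξ.1 := rfl

theorem IsTame.conormalAlgebroid_bracket (hE : E.IsTame)
    (s t : Sections (q + p) (CotMod (q + p)) (Cot (q + p) (M := M)) 𝓕.conormal) :
    ⇑((hE.conormalAlgebroid hh).bracket s t).1 =
      E.formBracket (fun x => ⟨s.1 x, s.2 x⟩) (fun x => ⟨t.1 x, t.2 x⟩) :=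
  funext fun x => (formBracket_eq hh s.2 t.2 x).symm

theorem IsTame.conormalAlgebroid_anchor (hE : E.IsTame) (x : M) (ξ : 𝓕.conormal x) :
    (hE.conormalAlgebroid hh).anchor x ξ = h.toFun x ξ := E.sharp_of_mem ξ.2

end ImageExtension
end FoliationHamiltonian

end

theorem proposition3p3 {q p : ℕ} {M : Type*} [TopologicalSpace M] [T2Space M]
    [ChartedSpace (FoliationHamiltonian.ModelSp (q + p)) M]
    [IsManifold 𝓘(ℝ, FoliationHamiltonian.ModelSp (q + p)) ∞ M]
    (𝓕 : FoliationHamiltonian.Foliation q p M)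
    (h : FoliationHamiltonian.ConormalMorphism 𝓕) (hh : h.IsHamiltonian)
    (E : FoliationHamiltonian.ImageExtension h) (hE : E.IsTame) :
    (∃! P : FoliationHamiltonian.BivectorField (q + p) M, E.Induces P) ∧
    ∀ P : FoliationHamiltonian.BivectorField (q + p) M, E.Induces P →
      P.IsPoisson ∧
      -- the cotangent Lie algebroid `b` of `(M, P)` and its subalgebroid `a`
      ∃ (b : FoliationHamiltonian.LieAlgebroid (q + p) (FoliationHamiltonian.CotMod (q + p))
            (FoliationHamiltonian.Cot (q + p) (M := M)) (fun _ => ⊤))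
        (a : FoliationHamiltonian.LieAlgebroid (q + p) (FoliationHamiltonian.CotMod (q + p))
            (FoliationHamiltonian.Cot (q + p) (M := M)) 𝓕.conormal),
        (∀ s t, ⇑(b.bracket s t).1 = P.formBracket s.1 t.1) ∧
        (∀ x ξ, b.anchor x ξ = P.sharp x ξ.1) ∧
        (∀ s t, ⇑(a.bracket s t).1 =
          E.formBracket (fun x => ⟨s.1 x, s.2 x⟩) (fun x => ⟨t.1 x, t.2 x⟩)) ∧
        (∀ x ξ, a.anchor x ξ = h.toFun x ξ) ∧
        a.IsSubalgebroid b := by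
  refine ⟨⟨E.poisson hh, E.induces_poisson hh, fun P hP => hP.eq_poisson hh⟩, fun P hP => ?_⟩
  rw [hP.eq_poisson hh]
  exact ⟨(hE.schoutenZero hh).isPoisson, hE.cotangentAlgebroid hh, hE.conormalAlgebroid hh,
    hE.cotangentAlgebroid_bracket hh, hE.cotangentAlgebroid_anchor hh,
    hE.conormalAlgebroid_bracket hh, hE.conormalAlgebroid_anchor hh, hE.isSubalgebroid hh⟩
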